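/- **Setup.** Fix $d\ge 1$, $l>0$, $\sigma>0$. Let $\mathcal X\subset[0,1]^d$ be finite and non-empty, and let $k$ be the SE kernel $k(x,x')=\exp(-\|x-x'\|^2/(2l^2))$ or the Matérn kernel $k(x,x')=\frac{2^{1-\nu}}{\Gamma(\nu)}r^{\nu}K_\nu(r)$, $r=\sqrt{2\nu}\,\|x-x'\|/l$, with smoothness $\nu>0$ (value $1$ at $x=x'$; $K_\nu$ is the modified Bessel function of the second kind). Let $f:\mathcal X\to\mathbb R$ have RKHS norm $\|f\|_k\le\Psi$, $\Psi>0$. Querying $x_t$ at time $t\in\{1,\dots,T\}$ yields $y_t=f(x_t)+z_t$ with $z_t\sim N(0,\sigma^2)$ i.i.d.; the answers in a batch are revealed when the batch ends. The regret is $R_T=\sum_{t=1}^T(\max_{\mathcal X} f-f(x_t))$. Let $\gamma_t$ be the maximum, over all choices of $t$ points of $\mathcal X$ (repetition allowed), of the mutual information between the values at these points of a centred Gaussian process with covariance $k$ and the values observed with independent $N(0,\sigma^2)$ noise. **Algorithm (BPE).** For $a\in(0,1)$ the batch sizes are $N_i=\min\{\lceil T^{1-a^i}\rceil,\;T-\sum_{j<i}N_j\}$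 for $i=1,\dots,B$, where $B$ is the least number of batches with $\sum_{i\le B}N_i=T$. Start with $\mathcal X_1=\mathcal X$. In batch $i$, choose $N_i$ points one after another, each maximizing over $\mathcal X_i$ the Gaussian process posterior standard deviation (regularization $\sigma^2$) given the earlier points of the same batch; ties are broken by an arbitrary deterministic rule depending only on the points queried so far and the set of maximizers. From the observations of the batch alone compute the posterior mean $\mu^i$ and standard deviation $\sigma^i$, and let $\mathcal X_{i+1}$ be the set of $x\in\mathcal X_i$ with $\mu^i(x)+\sqrt\beta\,\sigma^i(x)\ge\max_{x'\in\mathcal X_i}\bigl(\mu^i(x')-\sqrt\beta\,\sigma^i(x')\bigr)$, where $\beta=\bigl(\Psi+\sqrt{2\log(|\mathcal X|B/\delta)}\bigr)^2$. **Theorem.** Write $\Lambda=\Psi+\sqrt{\log(|\mathcal X|/\delta)}$. 1. Let $k$ be the SE or the Matérn kernel and $a\in(\frac12,1)$. There are $C,T_0$, depending only on $(d,l,\sigma,a)$ and, for Matérn, $\nu$, such that for all $T\ge T_0$, all $\mathcal X$, $\Psi$, $f$ as above and all $\delta\in(0,1)$, BPE satisfies with probability at least $1-\delta$ $$R_T\le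 C\bigl(\Lambda+\sqrt{\log\log\log T}\bigr)\sqrt{T\gamma_T}.$$ 2. Let $k$ be the Matérn kernel and $a\in(\frac{\nu}{2\nu+d},\frac12]$. Let $\overline\gamma_t=c'\,t^{d/(2\nu+d)}\alpha_t$ for $t\ge1$, with a constant $c'>0$ and a non-decreasing sequence $(\alpha_t)_{t\ge1}$, and let $t_0$ be given. There are $C,T_0$, depending only on $(d,\nu,l,\sigma,a)$, the sequence $\overline\gamma$ and $t_0$, such that for all $T\ge T_0$, all $\mathcal X$ for which $\gamma_t\le\overline\gamma_t$ for every $t\ge \max(t_0,1)$, all $\Psi$, $f$ as above and all $\delta\in(0,1)$, BPE satisfies with probability at least $1-\delta$ $$R_T\le C\bigl(\Lambda+\sqrt{\log\log\log T}\bigr)\sqrt{T\,\overline\gamma_T}.$$ -/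

import Mathlib

open MeasureTheory ProbabilityTheory Matrix

universe u

noncomputable section

namespace BatchedKernelBandit

/-! ### Kernels -/

/-- The squared exponential kernel with length-scale `l` on `ℝ^d`. -/
def seKernel {d : ℕ} (l : ℝ) (x y : EuclideanSpace ℝ (Fin d)) : ℝ :=
  Real.exp (-(dist x y) ^ 2 / (2 * l ^ 2))

/-- The modified Bessel function of the second kind of order `ν`, for positive real argument `z`,
through its integral representation `K_ν(z) = ∫_0^∞ exp(-z cosh t) cosh(ν t) dt`. -/
def besselK (ν z : ℝ) : ℝ :=
  ∫ t in Set.Ioi (0 : ℝ), Real.exp (-z * Real.cosh t) * Real.cosh (ν * t)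

/-- The Matérn kernel with smoothness `ν` and length-scale `l` on `ℝ^d`. On the diagonal, where the
closed formula is an indeterminate product `0 * ∞`, it has the limit value `1`. -/
def maternKernel {d : ℕ} (ν l : ℝ) (x y : EuclideanSpace ℝ (Fin d)) : ℝ :=
  open Classical in
  if x = y then 1
  else 2 ^ (1 - ν) / Real.Gamma ν * (√(2 * ν) * dist x y / l) ^ ν *
    besselK ν (√(2 * ν) * dist x y / l)

/-- `f` lies in the reproducing kernel Hilbert space of functions on `α` with (scalar) kernel `k`,
and its norm there is at most `Ψ`. -/
def RKHSNormLE {α : Type} (k : α → α → ℝ) (f : α → ℝ) (Ψ : ℝ) : Prop :=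
  ∃ (H : Type) (_ : NormedAddCommGroup H) (_ : InnerProductSpace ℝ H) (_ : CompleteSpace H)
    (_ : RKHS ℝ H α ℝ),
    (∀ x y : α, RKHS.kernel H x y = k x y • ContinuousLinearMap.id ℝ ℝ) ∧
      ∃ h : H, (∀ x, h x = f x) ∧ ‖h‖ ≤ Ψ

/-! ### Gaussian process posterior -/

/-- The kernel matrix `[k(p_i, p_j)]_{i,j}` of a finite sequence of points. -/
def gram {α : Type} (k : α → α → ℝ) {n : ℕ} (p : Fin n → α) : Matrix (Fin n) (Fin n) ℝ :=
  Matrix.of fun i j => k (p i) (p j)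

/-- The posterior mean at `x` after observing the values `y` at the points `p`, with regularization
parameter `σ²`. -/
def postMean {α : Type} (k : α → α → ℝ) (σ : ℝ) {n : ℕ} (p : Fin n → α) (y : Fin n → ℝ)
    (x : α) : ℝ :=
  (fun i => k (p i) x) ⬝ᵥ ((gram k p + σ ^ 2 • (1 : Matrix (Fin n) (Fin n) ℝ))⁻¹ *ᵥ y)

/-- The posterior variance at `x` after sampling the points `p`. -/
def postVar {α : Type} (k : α → α → ℝ) (σ : ℝ) {n : ℕ} (p : Fin n → α) (x : α) : ℝ :=
  k x x - (fun i => k (p i) x) ⬝ᵥ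
    ((gram k p + σ ^ 2 • (1 : Matrix (Fin n) (Fin n) ℝ))⁻¹ *ᵥ fun i => k (p i) x)

/-- The posterior standard deviation. -/
def postStd {α : Type} (k : α → α → ℝ) (σ : ℝ) {n : ℕ} (p : Fin n → α) (x : α) : ℝ :=
  √(postVar k σ p x)

/-! ### Maximum information gain -/

/-- The mutual information (in nats) of the two components of a random pair with joint law `P`. -/
def mutualInfo {A B : Type} [MeasurableSpace A] [MeasurableSpace B] (P : Measure (A × B)) :
    ENNReal :=
  InformationTheory.klDiv P (P.fst.prod P.snd)

/-- The joint law of `(f_A, y_A)`, where `f_A` is the vector of values at the points `p` of a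
centred Gaussian process with covariance `k`, and `y_A = f_A + z` with `z ∼ N(0, σ² I)` independent
of `f_A`. -/
def gpObsLaw {α : Type} (k : α → α → ℝ) (σ : ℝ) {n : ℕ} (p : Fin n → α) :
    Measure (EuclideanSpace ℝ (Fin n) × EuclideanSpace ℝ (Fin n)) :=
  ((multivariateGaussian 0 (gram k p)).prod
    (multivariateGaussian 0 (σ ^ 2 • (1 : Matrix (Fin n) (Fin n) ℝ)))).map
      fun u => (u.1, u.1 + u.2)

/-- The maximum information gain `γ_t`: the largest mutual information between the values and the
noisy observations over all choices of `t` sampling points (with repetition) from the domain. -/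
def maxInfoGain {α : Type} (k : α → α → ℝ) (σ : ℝ) (t : ℕ) : ℝ :=
  (⨆ p : Fin t → α, mutualInfo (gpObsLaw k σ p)).toReal

/-! ### Batch sizes -/

/-- The total `N_1 + ⋯ + N_i` of the first `i` batch sizes, where
`N_i = min {⌈T^(1 - a^i)⌉, T - ∑_{j=1}^{i-1} N_j}`. -/
def batchTotal (a : ℝ) (T : ℕ) : ℕ → ℕ
  | 0 => 0
  | i + 1 => batchTotal a T i + min ⌈(T : ℝ) ^ (1 - a ^ (i + 1))⌉₊ (T - batchTotal a T i)

/-- The batch size `N_i`, for `i ≥ 1` (the value at `i = 0` is not used). -/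
def batchSize (a : ℝ) (T : ℕ) (i : ℕ) : ℕ :=
  min ⌈(T : ℝ) ^ (1 - a ^ i)⌉₊ (T - batchTotal a T (i - 1))

theorem batchTotal_eq_sum (a : ℝ) (T n : ℕ) :
    batchTotal a T n = ∑ i ∈ Finset.Icc 1 n, batchSize a T i := by
  induction n with
  | zero => simp [batchTotal]
  | succ n ih => rw [Finset.sum_Icc_succ_top (by omega), ← ih]; simp [batchTotal, batchSize]

/-- The number of batches `B`: the least number of batches whose sizes add up to the horizon. -/
def numBatches (a : ℝ) (T : ℕ) : ℕ :=
  sInf {n : ℕ | batchTotal a T n = T}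

/-! ### The batched pure exploration (BPE) algorithm -/

/-- A deterministic rule for breaking ties: given the list of all points queried so far and a
nonempty finite set of candidates, it returns one of the candidates. -/
def IsTieBreak {α : Type} (tie : List α → Finset α → α) : Prop :=
  ∀ q S, S.Nonempty → tie q S ∈ S

open Classical in
/-- The maximizers over `A` of the posterior standard deviation given the sampled points `S`. -/
def maxStdSet {α : Type} (k : α → α → ℝ) (σ : ℝ) (S : List α) (A : Finset α) : Finset α :=
  A.filter fun x => ∀ x' ∈ A, postStd k σ S.get x' ≤ postStd k σ S.get x

/-- The first `j` points of a batch that starts with active set `A` after the queries `q`: each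
point maximizes over `A` the posterior standard deviation given the previous points of the same
batch. -/
def bpeBatch {α : Type} (k : α → α → ℝ) (σ : ℝ) (tie : List α → Finset α → α) (q : List α)
    (A : Finset α) : ℕ → List α
  | 0 => []
  | j + 1 =>
    bpeBatch k σ tie q A j ++
      [tie (q ++ bpeBatch k σ tie q A j) (maxStdSet k σ (bpeBatch k σ tie q A j) A)]

/-- Upper confidence bound. -/
def ucb {α : Type} (k : α → α → ℝ) (σ β : ℝ) (S : List α) (y : Fin S.length → ℝ) (x : α) : ℝ :=
  postMean k σ S.get y x + √β * postStd k σ S.get x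

/-- Lower confidence bound. -/
def lcb {α : Type} (k : α → α → ℝ) (σ β : ℝ) (S : List α) (y : Fin S.length → ℝ) (x : α) : ℝ :=
  postMean k σ S.get y x - √β * postStd k σ S.get x

open Classical in
/-- The points of the active set whose upper confidence bound is at least the largest lower
confidence bound over the active set. -/
def eliminate {α : Type} (k : α → α → ℝ) (σ β : ℝ) (S : List α) (y : Fin S.length → ℝ)
    (A : Finset α) : Finset α :=
  A.filter fun x => ∀ x' ∈ A, lcb k σ β S y x' ≤ ucb k σ β S y x

/-- The state of BPE after `i` batches with batch sizes `N 1, N 2, …`: the active set and the list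
of all points queried so far. The query at (zero-based) time `t` is answered by the value of `f` at
the queried point plus the noise `z t`, and these answers are used only after the batch. -/
def bpeState {α : Type} [Fintype α] (k : α → α → ℝ) (σ β : ℝ) (tie : List α → Finset α → α)
    (N : ℕ → ℕ) (f : α → ℝ) (z : ℕ → ℝ) : ℕ → Finset α × List α
  | 0 => (Finset.univ, [])
  | i + 1 =>
    let A := (bpeState k σ β tie N f z i).1
    let q := (bpeState k σ β tie N f z i).2
    let S := bpeBatch k σ tie q A (N (i + 1))
    (eliminate k σ β S (fun j => f (S.get j) + z (q.length + j)) A, q ++ S)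

/-- The confidence parameter `β = (Ψ + √(2 log(n B / δ)))²` for a domain with `n` points. -/
def bpeBeta (Ψ δ : ℝ) (n B : ℕ) : ℝ :=
  (Ψ + √(2 * Real.log (n * B / δ))) ^ 2

/-- The list of all points queried by BPE, with horizon `T` and batch-size parameter `a`. -/
def bpeQueries {α : Type} [Fintype α] (k : α → α → ℝ) (σ a Ψ δ : ℝ) (T : ℕ)
    (tie : List α → Finset α → α) (f : α → ℝ) (z : ℕ → ℝ) : List α :=
  (bpeState k σ (bpeBeta Ψ δ (Fintype.card α) (numBatches a T)) tie (batchSize a T) f z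
    (numBatches a T)).2

/-- The cumulative regret `∑_t (max f - f (x_t))` of a list of queries. -/
def cumRegret {α : Type} (f : α → ℝ) (q : List α) : ℝ :=
  (q.map fun x => (⨆ x', f x') - f x).sum

/-- For every `f` with RKHS norm at most `Ψ`, every confidence level `δ` and independent `N(0, σ²)`
noise, with probability at least `1 - δ` the cumulative regret of BPE on the finite domain `X` is
at most `C (Λ + √(log log log T)) √(T g)`, where `Λ = Ψ + √(log (|X| / δ))`. -/
def BPERegretBound {d : ℕ}
    (κ : EuclideanSpace ℝ (Fin d) → EuclideanSpace ℝ (Fin d) → ℝ) (σ a : ℝ)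
    (X : Finset (EuclideanSpace ℝ (Fin d))) (T : ℕ) (C g : ℝ) : Prop :=
  ∀ (Ψ : ℝ), 0 < Ψ →
  ∀ (f : X → ℝ), RKHSNormLE (fun x y : X => κ x y) f Ψ →
  ∀ (tie : List X → Finset X → X), IsTieBreak tie →
  ∀ (δ : ℝ), 0 < δ → δ < 1 →
  ∀ (Ω : Type u) [MeasurableSpace Ω] (P : Measure Ω) [IsProbabilityMeasure P] (z : ℕ → Ω → ℝ),
    (∀ t, Measurable (z t)) → iIndepFun z P →
    (∀ t, P.map (z t) = gaussianReal 0 (σ ^ 2).toNNReal) →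
    1 - δ ≤ P.real {ω |
      cumRegret f (bpeQueries (fun x y : X => κ x y) σ a Ψ δ T tie f (fun t => z t ω)) ≤
        C * ((Ψ + √(Real.log (X.card / δ))) + √(Real.log (Real.log (Real.log T)))) * √(T * g)}

end BatchedKernelBandit

end

open BatchedKernelBandit

/-!
The proof is the analysis of pure exploration with eliminations. It uses only that the kernel has
unit diagonal and is positive semidefinite; the latter follows from the RKHS hypothesis
(`RKHSNormLE.isPSDKernel`), so nothing about Bessel functions is needed.

*Confidence.* The points of a batch are determined by the earlier batches, hence independent of
the noise of the batch. Conditionally on the past, the error of the posterior mean at `x` is a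
bias of at most `Ψ σⁱ(x)` plus a centred Gaussian of standard deviation at most `σⁱ(x)`
(`RKHSNormLE.noise_gt_of_miss`). The bound `P(|Z| > u) ≤ exp (-u²/2)` and a union bound over
points and batches give total failure probability at most `δ`
(`one_sub_le_measureReal_confidence`).

*Information gain.* The mutual information of a Gaussian channel is `½ log det (I + σ⁻² K)`
(`mutualInfo_channelLaw`). By the chain rule for this determinant it is a sum of
`½ log (1 + σ⁻² σⱼ²)` over the posterior variances of the chosen points, and as the points are
chosen greedily, after `N` queries every active point has posterior variance of order `γ_N / N`
(`IsPSDKernel.mul_postVar_bpeBatch_le`).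

*Regret.* On the confidence event a maximizer is never eliminated and a point surviving batch `i`
has a gap of at most `4 √β max σⁱ`. So batch `i ≥ 2` costs at most a constant times
`√β N_i √(γ_{N_{i-1}} / N_{i-1})`. If `γ_N ≤ g (N / T) ^ θ`, this is of order
`√β √(T g) T ^ (-c a ^ (i-1))` with `c = a - (1 - θ) / 2 > 0` (`batch_term_le`). The schedule
ends so early that `a ^ (B-1) log T ≥ a ^ 3` for the number of batches `B`, so these errors decay
geometrically from the last batch backwards and add up to a constant (`sum_exp_neg_le`), while
`log B` is of order `log log log T` (`log_numBatches_le`). The case `a > 1/2` is `θ = 0`,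
`g = γ_T`; the Matérn case `a ≤ 1/2` is `θ = d / (2ν + d)`, `g = γbar_T`, where
`(1 - θ) / 2 = ν / (2ν + d)`.
-/

noncomputable section

namespace BatchedKernelBandit

/-! ### Kernel matrices and the posterior variance -/

section

variable {α : Type} {k : α → α → ℝ} {σ : ℝ}

/-- A real kernel all of whose kernel matrices are positive semidefinite. -/
def IsPSDKernel (k : α → α → ℝ) : Prop :=
  ∀ ⦃n : ℕ⦄ (p : Fin n → α), (gram k p).PosSemidef

/-- The power function: the squared RKHS norm of `k(·, x) - ∑ i, w i • k(·, p i)`. -/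
def powerFun (k : α → α → ℝ) {n : ℕ} (p : Fin n → α) (w : Fin n → ℝ) (x : α) : ℝ :=
  k x x - 2 * (w ⬝ᵥ fun i => k (p i) x) + w ⬝ᵥ (gram k p *ᵥ w)

/-- An RKHS supplies a feature map for its kernel, and the bounded function `f` is the inner
product of the features with a vector of norm at most `Ψ`. -/
theorem exists_featureMap {f : α → ℝ} {Ψ : ℝ} (h : RKHSNormLE k f Ψ) :
    ∃ (H : Type) (_ : NormedAddCommGroup H) (_ : InnerProductSpace ℝ H) (φ : α → H) (h : H),
      (∀ x y, inner ℝ (φ x) (φ y) = k x y) ∧ (∀ x, f x = inner ℝ (φ x) h) ∧ ‖h‖ ≤ Ψ := by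
  obtain ⟨H, _, _, _, _, hk, h, hf, hΨ⟩ := h
  refine ⟨H, inferInstance, inferInstance, fun x => RKHS.kerFun H x (1 : ℝ), h, ?_, ?_, hΨ⟩
  · intro x y
    rw [RKHS.kerFun_inner, RKHS.kerFun_apply, hk]
    simp
  · intro x
    rw [RKHS.kerFun_inner, ← hf]
    simp

theorem RKHSNormLE.isPSDKernel {f : α → ℝ} {Ψ : ℝ} (h : RKHSNormLE k f Ψ) : IsPSDKernel k := by
  obtain ⟨H, _, _, φ, h, hφ, -, -⟩ := exists_featureMap h
  intro n p
  refine Matrix.PosSemidef.of_dotProduct_mulVec_nonneg ?_ fun w => ?_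
  · ext i j
    simp [gram, ← hφ, real_inner_comm]
  · have : star w ⬝ᵥ (gram k p *ᵥ w) = inner ℝ (∑ i, w i • φ (p i)) (∑ i, w i • φ (p i)) := by
      simp only [sum_inner, inner_sum, inner_smul_left, inner_smul_right, hφ, dotProduct, mulVec,
        gram, of_apply, Finset.mul_sum]
      simp only [star_trivial, conj_trivial]
      refine Finset.sum_congr rfl fun i _ => Finset.sum_congr rfl fun j _ => ?_
      rw [← hφ, ← hφ, real_inner_comm]
      ring
    rw [this]
    exact real_inner_self_nonneg

/-- The noiseless interpolation error, by Cauchy–Schwarz in the RKHS. -/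
theorem RKHSNormLE.abs_sub_sum_le {f : α → ℝ} {Ψ : ℝ} (h : RKHSNormLE k f Ψ) {n : ℕ}
    (p : Fin n → α) (w : Fin n → ℝ) (x : α) :
    |f x - ∑ i, w i * f (p i)| ≤ Ψ * √(powerFun k p w x) := by
  obtain ⟨H, _, _, φ, h, hφ, hf, hΨ⟩ := exists_featureMap h
  have h1 : f x - ∑ i, w i * f (p i) = inner ℝ (φ x - ∑ i, w i • φ (p i)) h := by
    simp [inner_sub_left, sum_inner, inner_smul_left, hf]
  have h2 : powerFun k p w x = ‖φ x - ∑ i, w i • φ (p i)‖ ^ 2 := by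
    rw [norm_sub_sq_real, ← real_inner_self_eq_norm_sq, ← real_inner_self_eq_norm_sq]
    simp only [sum_inner, inner_sum, inner_smul_left, inner_smul_right, hφ, dotProduct, mulVec,
      gram, of_apply, Finset.mul_sum, powerFun, conj_trivial]
    have : ∀ i, k x (p i) = k (p i) x := fun i => by rw [← hφ, ← hφ, real_inner_comm]
    simp only [this]
    congr 1
    refine Finset.sum_congr rfl fun i _ => Finset.sum_congr rfl fun j _ => ?_
    rw [← hφ, ← hφ, real_inner_comm]
    ring
  rw [h1, h2, Real.sqrt_sq (norm_nonneg _), mul_comm]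
  exact (abs_real_inner_le_norm _ _).trans (by gcongr)

/-- The kernel matrix with the ridge `σ²` added to its diagonal. -/
def ridgeGram (k : α → α → ℝ) (σ : ℝ) {n : ℕ} (p : Fin n → α) : Matrix (Fin n) (Fin n) ℝ :=
  gram k p + σ ^ 2 • (1 : Matrix (Fin n) (Fin n) ℝ)

/-- The weights `w` for which the posterior mean at `x` is `∑ i, w i * y i`. -/
def ridgeWeights (k : α → α → ℝ) (σ : ℝ) {n : ℕ} (p : Fin n → α) (x : α) : Fin n → ℝ :=
  (ridgeGram k σ p)⁻¹ *ᵥ fun i => k (p i) x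

theorem IsPSDKernel.symm (hk : IsPSDKernel k) (x y : α) : k x y = k y x := by
  have := congrFun (congrFun (hk ![x, y]).isHermitian 1) 0
  simpa [gram] using this

theorem IsPSDKernel.posDef_ridgeGram (hk : IsPSDKernel k) (hσ : 0 < σ) {n : ℕ} (p : Fin n → α) :
    (ridgeGram k σ p).PosDef :=
  Matrix.PosDef.posSemidef_add (hk p) ((Matrix.PosDef.one).smul (by positivity))

theorem IsPSDKernel.transpose_inv_ridgeGram (hk : IsPSDKernel k) (hσ : 0 < σ) {n : ℕ}
    (p : Fin n → α) : ((ridgeGram k σ p)⁻¹)ᵀ = (ridgeGram k σ p)⁻¹ := by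
  simpa using (hk.posDef_ridgeGram hσ p).isHermitian.inv.eq

theorem IsPSDKernel.postMean_eq (hk : IsPSDKernel k) (hσ : 0 < σ) {n : ℕ} (p : Fin n → α)
    (y : Fin n → ℝ) (x : α) : postMean k σ p y x = ∑ i, ridgeWeights k σ p x i * y i := by
  change _ = ridgeWeights k σ p x ⬝ᵥ y
  rw [ridgeWeights, postMean, dotProduct_mulVec, ← mulVec_transpose]
  change ((ridgeGram k σ p)⁻¹ᵀ *ᵥ _) ⬝ᵥ _ = _
  rw [hk.transpose_inv_ridgeGram hσ]

/-- Completing the square: the ridge weights minimize the noise-penalized power function, and the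
minimum is the posterior variance. -/
theorem IsPSDKernel.powerFun_add (hk : IsPSDKernel k) (hσ : 0 < σ) {n : ℕ} (p : Fin n → α)
    (w : Fin n → ℝ) (x : α) :
    powerFun k p w x + σ ^ 2 * (w ⬝ᵥ w) = postVar k σ p x +
      (w - ridgeWeights k σ p x) ⬝ᵥ (ridgeGram k σ p *ᵥ (w - ridgeWeights k σ p x)) := by
  have hpd := hk.posDef_ridgeGram hσ p
  set M := ridgeGram k σ p with hM
  set b : Fin n → ℝ := fun i => k (p i) x with hb
  set v := ridgeWeights k σ p x with hv
  have hMv : M *ᵥ v = b := by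
    rw [hv, ridgeWeights, mulVec_mulVec, Matrix.mul_nonsing_inv _ hpd.det_pos.ne'.isUnit,
      one_mulVec]
  have hsymm : ∀ a c : Fin n → ℝ, a ⬝ᵥ (M *ᵥ c) = c ⬝ᵥ (M *ᵥ a) := by
    intro a c
    rw [dotProduct_mulVec, ← mulVec_transpose, dotProduct_comm]
    congr 2
    simpa using hpd.isHermitian.eq
  have h1 : postVar k σ p x = k x x - b ⬝ᵥ v := rfl
  have h2 : w ⬝ᵥ (M *ᵥ w) = w ⬝ᵥ (gram k p *ᵥ w) + σ ^ 2 * (w ⬝ᵥ w) := by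
    rw [hM, ridgeGram, add_mulVec, dotProduct_add, smul_mulVec, one_mulVec, dotProduct_smul,
      smul_eq_mul]
  rw [h1, mulVec_sub, dotProduct_sub, sub_dotProduct, sub_dotProduct, hsymm v w, h2, hMv,
    dotProduct_comm b v]
  simp only [powerFun]
  ring

theorem IsPSDKernel.postVar_le (hk : IsPSDKernel k) (hσ : 0 < σ) {n : ℕ} (p : Fin n → α)
    (w : Fin n → ℝ) (x : α) : postVar k σ p x ≤ powerFun k p w x + σ ^ 2 * (w ⬝ᵥ w) := by
  rw [hk.powerFun_add hσ]
  have := (hk.posDef_ridgeGram hσ p).posSemidef.dotProduct_mulVec_nonneg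
    (w - ridgeWeights k σ p x)
  simp only [star_trivial] at this
  linarith

theorem IsPSDKernel.powerFun_ridgeWeights (hk : IsPSDKernel k) (hσ : 0 < σ) {n : ℕ}
    (p : Fin n → α) (x : α) :
    powerFun k p (ridgeWeights k σ p x) x +
      σ ^ 2 * (ridgeWeights k σ p x ⬝ᵥ ridgeWeights k σ p x) = postVar k σ p x := by
  rw [hk.powerFun_add hσ]; simp

theorem IsPSDKernel.powerFun_snoc (hk : IsPSDKernel k) {n : ℕ} (p : Fin n → α) (w : Fin n → ℝ)
    (x a : α) (c : ℝ) :
    powerFun k (Fin.snoc p a : Fin (n + 1) → α) (Fin.snoc w c : Fin (n + 1) → ℝ) x =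
      powerFun k p w x - 2 * c * k a x + 2 * c * (w ⬝ᵥ fun i => k (p i) a) + c ^ 2 * k a a := by
  simp only [powerFun, dotProduct, mulVec, gram, of_apply, Fin.sum_univ_castSucc, Fin.snoc_castSucc,
    Fin.snoc_last, mul_add, Finset.sum_add_distrib, Finset.mul_sum, hk.symm a]
  have h : ∑ i, c * (k (p i) a * w i) = ∑ i, c * (w i * k (p i) a) :=
    Finset.sum_congr rfl fun i _ => by ring
  have h' : ∑ i, w i * (k (p i) a * c) = ∑ i, c * (w i * k (p i) a) :=
    Finset.sum_congr rfl fun i _ => by ring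
  rw [h, h']
  simp only [mul_assoc, ← Finset.mul_sum]
  ring

/-- Conditioning on one more point lowers the posterior variance: the old weights, extended by `0`,
are admissible in the new minimization. -/
theorem IsPSDKernel.postVar_snoc_le (hk : IsPSDKernel k) (hσ : 0 < σ) {n : ℕ} (p : Fin n → α)
    (a x : α) : postVar k σ (Fin.snoc p a : Fin (n + 1) → α) x ≤ postVar k σ p x := by
  refine (hk.postVar_le hσ _ (Fin.snoc (ridgeWeights k σ p x) 0 : Fin (n + 1) → ℝ) x).trans ?_
  rw [hk.powerFun_snoc, ← hk.powerFun_ridgeWeights hσ p x]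
  simp [dotProduct, Fin.sum_univ_castSucc]

/-- The power function is the quadratic form of the kernel matrix of the points `p, x` at `(w, -1)`.
-/
theorem IsPSDKernel.powerFun_nonneg (hk : IsPSDKernel k) {n : ℕ} (p : Fin n → α)
    (w : Fin n → ℝ) (x : α) : 0 ≤ powerFun k p w x := by
  have h := (hk (Fin.snoc p x : Fin (n + 1) → α)).dotProduct_mulVec_nonneg
    (Fin.snoc w (-1) : Fin (n + 1) → ℝ)
  have h2 := hk.powerFun_snoc p w x x (-1)
  simp only [star_trivial] at h
  rw [powerFun] at h2
  have h3 : (Fin.snoc w (-1) : Fin (n + 1) → ℝ) ⬝ᵥ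
      (fun i => k ((Fin.snoc p x : Fin (n + 1) → α) i) x) =
      w ⬝ᵥ (fun i => k (p i) x) - k x x := by
    simp [dotProduct, Fin.sum_univ_castSucc, sub_eq_add_neg]
  rw [h3] at h2
  nlinarith [h, h2]

theorem IsPSDKernel.postVar_nonneg (hk : IsPSDKernel k) (hσ : 0 < σ) {n : ℕ}
    (p : Fin n → α) (x : α) : 0 ≤ postVar k σ p x := by
  rw [← hk.powerFun_ridgeWeights hσ]
  have := hk.powerFun_nonneg p (ridgeWeights k σ p x) x
  have : 0 ≤ ridgeWeights k σ p x ⬝ᵥ ridgeWeights k σ p x :=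
    Finset.sum_nonneg fun i _ => mul_self_nonneg _
  positivity

theorem postVar_zero (p : Fin 0 → α) (x : α) : postVar k σ p x = k x x := by
  simp [postVar]

/-- The chain rule for the determinant of the regularized kernel matrix (Schur complement). -/
theorem IsPSDKernel.det_ridgeGram_snoc (hk : IsPSDKernel k) (hσ : 0 < σ) {n : ℕ} (p : Fin n → α)
    (a : α) : (ridgeGram k σ (Fin.snoc p a : Fin (n + 1) → α)).det =
      (ridgeGram k σ p).det * (σ ^ 2 + postVar k σ p a) := by
  have hpd := hk.posDef_ridgeGram hσ p
  have : Invertible (ridgeGram k σ p) := Matrix.invertibleOfIsUnitDet _ hpd.det_pos.ne'.isUnit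
  have hblock : (ridgeGram k σ (Fin.snoc p a : Fin (n + 1) → α)).submatrix
        (finSumFinEquiv : Fin n ⊕ Fin 1 ≃ Fin (n + 1)) finSumFinEquiv =
      fromBlocks (ridgeGram k σ p) (of fun i _ => k (p i) a) (of fun _ j => k a (p j))
        (of fun _ _ => k a a + σ ^ 2) := by
    have hl : ∀ j : Fin 1, Fin.natAdd n j = Fin.last n := fun j => by
      ext; simp
    have hne : ∀ i : Fin n, Fin.castAdd 1 i = Fin.castSucc i := fun i => rfl
    ext i j
    rcases i with i | i <;> rcases j with j | j <;>
      simp [ridgeGram, gram, hl, hne, Fin.snoc_castSucc, Fin.snoc_last, Matrix.one_apply,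
        (Fin.castSucc_lt_last _).ne, (Fin.castSucc_lt_last _).ne']
  rw [← det_submatrix_equiv_self (finSumFinEquiv : Fin n ⊕ Fin 1 ≃ Fin (n + 1)), hblock,
    det_fromBlocks₁₁]
  congr 1
  rw [det_unique, invOf_eq_nonsing_inv]
  rw [Matrix.sub_apply, Matrix.mul_assoc, Matrix.mul_apply]
  change k a a + σ ^ 2 - ∑ i, k a (p i) * ridgeWeights k σ p a i =
    σ ^ 2 + (k a a - ∑ i, k (p i) a * ridgeWeights k σ p a i)
  simp only [hk.symm a]
  ring

end

/-! ### Gaussian densities -/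

/-- The Lebesgue density of the centred Gaussian law on `ℝⁿ` with invertible covariance `S`. -/
def gaussDensity {n : ℕ} (S : Matrix (Fin n) (Fin n) ℝ) (x : EuclideanSpace ℝ (Fin n)) : ℝ :=
  ((2 * Real.pi) ^ ((n : ℝ) / 2))⁻¹ * (√S.det)⁻¹ * Real.exp (-(x ⬝ᵥ S⁻¹ *ᵥ x) / 2)

theorem measurable_quadratic {n : ℕ} (B : Matrix (Fin n) (Fin n) ℝ) :
    Measurable fun x : EuclideanSpace ℝ (Fin n) => x ⬝ᵥ B *ᵥ x := by
  simp only [dotProduct, mulVec]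
  fun_prop

theorem measurable_gaussDensity {n : ℕ} (S : Matrix (Fin n) (Fin n) ℝ) :
    Measurable (gaussDensity S) := by
  have := measurable_quadratic S⁻¹
  unfold gaussDensity
  fun_prop

theorem gaussDensity_pos {n : ℕ} {S : Matrix (Fin n) (Fin n) ℝ} (hS : S.PosDef)
    (x : EuclideanSpace ℝ (Fin n)) : 0 < gaussDensity S x := by
  have := hS.det_pos
  unfold gaussDensity
  positivity

theorem gaussDensity_one {n : ℕ} (x : EuclideanSpace ℝ (Fin n)) :
    gaussDensity 1 x = ((2 * Real.pi) ^ ((n : ℝ) / 2))⁻¹ * Real.exp (-(1 / 2) * ‖x‖ ^ 2) := by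
  simp only [gaussDensity, det_one, Real.sqrt_one, inv_one, mul_one, one_mulVec,
    EuclideanSpace.real_norm_sq_eq, dotProduct]
  congr 2
  simp only [pow_two]
  ring

/-- The standard Gaussian law has the expected density, because both have the same characteristic
function. -/
theorem stdGaussian_eq_withDensity (n : ℕ) :
    stdGaussian (EuclideanSpace ℝ (Fin n)) =
      volume.withDensity fun x => ENNReal.ofReal (gaussDensity 1 x) := by
  have hint : Integrable (gaussDensity (1 : Matrix (Fin n) (Fin n) ℝ)) := by
    have h1 : Integrable fun x : EuclideanSpace ℝ (Fin n) => Real.exp (-(1 / 2) * ‖x‖ ^ 2) := by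
      by_contra h
      have h2 := GaussianFourier.integral_rexp_neg_mul_sq_norm (V := EuclideanSpace ℝ (Fin n))
        (show (0 : ℝ) < 1 / 2 by norm_num)
      rw [integral_undef h] at h2
      have : (0 : ℝ) < (Real.pi / (1 / 2)) ^
          (Module.finrank ℝ (EuclideanSpace ℝ (Fin n)) / 2 : ℝ) := by
        positivity
      linarith
    simpa only [← gaussDensity_one] using h1.const_mul ((2 * Real.pi) ^ ((n : ℝ) / 2))⁻¹
  have : IsFiniteMeasure (volume.withDensity fun x : EuclideanSpace ℝ (Fin n) =>
      ENNReal.ofReal (gaussDensity 1 x)) :=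
    isFiniteMeasure_withDensity_ofReal hint.2
  refine Measure.ext_of_charFun ?_
  ext t
  rw [charFun_stdGaussian, charFun_apply, integral_withDensity_eq_integral_toReal_smul
    (measurable_gaussDensity 1).ennreal_ofReal (by simp)]
  have h := GaussianFourier.integral_cexp_neg_mul_sq_norm_add (V := EuclideanSpace ℝ (Fin n))
    (b := 1 / 2) (by norm_num) Complex.I t
  have hpow : (((2 * Real.pi) ^ ((n : ℝ) / 2) : ℝ) : ℂ) =
      (Real.pi / (1 / 2 : ℂ)) ^ (Module.finrank ℝ (EuclideanSpace ℝ (Fin n)) / 2 : ℂ) := by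
    rw [Complex.ofReal_cpow (by positivity)]
    push_cast
    congr 1
    · ring
    · simp
  have h0 : (Real.pi / (1 / 2 : ℂ)) ^
      (Module.finrank ℝ (EuclideanSpace ℝ (Fin n)) / 2 : ℂ) ≠ 0 := by
    rw [← hpow]
    exact_mod_cast (by positivity : (0 : ℝ) < (2 * Real.pi) ^ ((n : ℝ) / 2)).ne'
  have h1 : ∀ x : EuclideanSpace ℝ (Fin n),
      (ENNReal.ofReal (gaussDensity 1 x)).toReal • Complex.exp (inner ℝ x t * Complex.I) =
      (((2 * Real.pi) ^ ((n : ℝ) / 2) : ℝ) : ℂ)⁻¹ *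
        Complex.exp (-(1 / 2) * ‖x‖ ^ 2 + Complex.I * inner ℝ t x) := by
    intro x
    rw [ENNReal.toReal_ofReal (gaussDensity_pos PosDef.one x).le, gaussDensity_one,
      Complex.real_smul, Complex.exp_add, real_inner_comm]
    push_cast
    ring_nf
  simp only [h1]
  rw [integral_const_mul, h, hpow, ← mul_assoc, inv_mul_cancel₀ h0, one_mul]
  congr 1
  simp
  ring

open scoped MatrixOrder Matrix.Norms.L2Operator in
/-- `N(0, S)` is the image of the standard Gaussian law under the symmetric matrix `√S`, whose
determinant is the Jacobian of the change of variables. -/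
theorem multivariateGaussian_eq_withDensity {n : ℕ} {S : Matrix (Fin n) (Fin n) ℝ}
    (hS : S.PosDef) : multivariateGaussian 0 S =
      volume.withDensity fun x => ENNReal.ofReal (gaussDensity S x) := by
  set A := CFC.sqrt S with hA
  have hAA : A * A = S := CFC.sqrt_mul_sqrt_self _ hS.posSemidef.nonneg
  have hAsymm : Aᵀ = A := by
    have := (CFC.sqrt_nonneg S).isSelfAdjoint
    simpa [IsSelfAdjoint, star_eq_conjTranspose] using this
  have hdetA : A.det * A.det = S.det := by rw [← det_mul, hAA]
  have hdet0 : A.det ≠ 0 := by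
    intro h; have := hS.det_pos; rw [← hdetA, h] at this; simp at this
  have habs : √S.det = |A.det| := by rw [← hdetA, Real.sqrt_mul_self_eq_abs]
  have hlin : LinearMap.det (toEuclideanCLM (𝕜 := ℝ) A :
      EuclideanSpace ℝ (Fin n) →ₗ[ℝ] EuclideanSpace ℝ (Fin n)) = A.det := by
    rw [coe_toEuclideanCLM_eq_toEuclideanLin, toEuclideanLin_eq_toLin_orthonormal]
    exact LinearMap.det_toLin _ _
  have hvol := Measure.map_linearMap_addHaar_eq_smul_addHaar
    (volume : Measure (EuclideanSpace ℝ (Fin n))) (hlin ▸ hdet0)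
  rw [hlin] at hvol
  have hquad : ∀ x : EuclideanSpace ℝ (Fin n),
      gaussDensity 1 x = |A.det| * gaussDensity S (toEuclideanCLM (𝕜 := ℝ) A x) := by
    intro x
    have hq : (toEuclideanCLM (𝕜 := ℝ) A x) ⬝ᵥ S⁻¹ *ᵥ (toEuclideanCLM (𝕜 := ℝ) A x) = x ⬝ᵥ x := by
      rw [ofLp_toEuclideanCLM, mulVec_mulVec, ← hAA, Matrix.mul_inv_rev, Matrix.mul_assoc,
        nonsing_inv_mul _ hdet0.isUnit, Matrix.mul_one, dotProduct_mulVec, vecMul_mulVec, hAsymm]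
      rw [mul_nonsing_inv _ hdet0.isUnit, vecMul_one]
    rw [gaussDensity, gaussDensity, hq, habs]
    have := abs_pos.2 hdet0
    simp
    field_simp
  rw [multivariateGaussian, stdGaussian_eq_withDensity]
  simp only [zero_add]
  have hm := measurable_gaussDensity S
  ext s hs
  rw [Measure.map_apply (by fun_prop) hs, withDensity_apply _ (hs.preimage (by fun_prop)),
    withDensity_apply _ hs]
  have hvol' : (volume : Measure (EuclideanSpace ℝ (Fin n))) =
      ENNReal.ofReal |A.det| • volume.map (toEuclideanCLM (𝕜 := ℝ) A) := by
    have h1 : volume.map (toEuclideanCLM (𝕜 := ℝ) A) =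
        ENNReal.ofReal |A.det⁻¹| • (volume : Measure (EuclideanSpace ℝ (Fin n))) := hvol
    rw [h1, smul_smul, ← ENNReal.ofReal_mul (abs_nonneg _), ← abs_mul, mul_inv_cancel₀ hdet0]
    simp
  conv_rhs => rw [hvol']
  rw [Measure.restrict_smul, lintegral_smul_measure,
    setLIntegral_map hs (by fun_prop) (by fun_prop),
    smul_eq_mul, ← lintegral_const_mul _ (by fun_prop)]
  refine lintegral_congr fun x => ?_
  rw [hquad, ENNReal.ofReal_mul (abs_nonneg _)]

theorem integrable_quadratic {n : ℕ} (μ : Measure (EuclideanSpace ℝ (Fin n))) [IsGaussian μ]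
    (B : Matrix (Fin n) (Fin n) ℝ) :
    Integrable (fun x : EuclideanSpace ℝ (Fin n) => x ⬝ᵥ B *ᵥ x) μ := by
  simp only [dotProduct, mulVec, Finset.mul_sum]
  refine integrable_finsetSum _ fun i _ => integrable_finsetSum _ fun j _ => ?_
  have h : ∀ i, MemLp (fun x : EuclideanSpace ℝ (Fin n) => x i) 2 μ := fun i =>
    (IsGaussian.memLp_two_id (μ := μ)).continuousLinearMap_comp
      (EuclideanSpace.proj i : EuclideanSpace ℝ (Fin n) →L[ℝ] ℝ)
  have := ((h i).integrable_mul (h j)).const_mul (B i j)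
  refine this.congr (ae_of_all _ fun x => ?_)
  simp only [Pi.mul_apply]
  ring

/-- The expectation of `xᵀ S⁻¹ x` under `N(0, S)` is `tr (S⁻¹ S) = n`. -/
theorem integral_quadratic_inv {n : ℕ} {S : Matrix (Fin n) (Fin n) ℝ} (hS : S.PosDef) :
    ∫ x, x ⬝ᵥ S⁻¹ *ᵥ x ∂(multivariateGaussian 0 S) = n := by
  set μ := multivariateGaussian 0 S with hμ
  have h : ∀ i, MemLp (fun x : EuclideanSpace ℝ (Fin n) => x i) 2 μ := fun i =>
    (IsGaussian.memLp_two_id (μ := μ)).continuousLinearMap_comp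
      (EuclideanSpace.proj i : EuclideanSpace ℝ (Fin n) →L[ℝ] ℝ)
  have hmean : ∀ i, ∫ x, x i ∂μ = 0 := fun i => by
    have := ContinuousLinearMap.integral_comp_comm
      (EuclideanSpace.proj i : EuclideanSpace ℝ (Fin n) →L[ℝ] ℝ) (IsGaussian.integrable_id (μ := μ))
    simpa [hμ] using this
  have hcov : ∀ i j, ∫ x, x i * x j ∂μ = S i j := fun i j => by
    rw [← covariance_eval_multivariateGaussian (μ := 0) hS.posSemidef i j,
      covariance_eq_sub (h i) (h j), hmean]
    simp [hμ]
  have hint : ∀ i j, Integrable (fun x : EuclideanSpace ℝ (Fin n) => x i * (S⁻¹ i j * x j)) μ := by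
    intro i j
    refine (((h i).integrable_mul (h j)).const_mul (S⁻¹ i j)).congr (ae_of_all _ fun x => ?_)
    simp only [Pi.mul_apply]
    ring
  have hval : ∀ i j, ∫ x, x i * (S⁻¹ i j * x j) ∂μ = S⁻¹ i j * S j i := fun i j => by
    rw [← hcov j i, ← integral_const_mul]
    congr 1; ext x; ring
  simp only [dotProduct, mulVec, Finset.mul_sum]
  rw [integral_finsetSum _ fun i _ => integrable_finsetSum _ fun j _ => hint i j]
  simp only [integral_finsetSum _ fun j _ => hint _ j, hval]
  have : S⁻¹ * S = 1 := nonsing_inv_mul _ hS.det_pos.ne'.isUnit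
  have h2 : ∀ i, ∑ j, S⁻¹ i j * S j i = 1 := fun i => by
    rw [← Matrix.mul_apply, this, one_apply_eq]
  simp [h2]

/-! ### Mutual information of the Gaussian observation channel -/

section
variable {n : ℕ} {K : Matrix (Fin n) (Fin n) ℝ} {σ : ℝ}

theorem conv_multivariateGaussian {S S' : Matrix (Fin n) (Fin n) ℝ} (hS : S.PosSemidef)
    (hS' : S'.PosSemidef) :
    (multivariateGaussian 0 S).conv (multivariateGaussian 0 S') =
      multivariateGaussian 0 (S + S') := by
  refine Measure.ext_of_charFun ?_
  ext t
  rw [charFun_conv, charFun_multivariateGaussian hS, charFun_multivariateGaussian hS',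
    charFun_multivariateGaussian (hS.add hS'), ← Complex.exp_add]
  congr 1
  simp [add_mulVec]
  ring

theorem posDef_sq_smul_one (hσ : 0 < σ) : (σ ^ 2 • (1 : Matrix (Fin n) (Fin n) ℝ)).PosDef :=
  PosDef.one.smul (by positivity)

/-- The density of the joint law of signal and observation with respect to the product of its
marginals. -/
def channelDensity (K : Matrix (Fin n) (Fin n) ℝ) (σ : ℝ)
    (u : EuclideanSpace ℝ (Fin n) × EuclideanSpace ℝ (Fin n)) : ℝ :=
  gaussDensity (σ ^ 2 • (1 : Matrix (Fin n) (Fin n) ℝ)) (u.2 - u.1) /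
    gaussDensity (K + σ ^ 2 • (1 : Matrix (Fin n) (Fin n) ℝ)) u.2

theorem measurable_channelDensity : Measurable (channelDensity K σ) := by
  have := measurable_gaussDensity (σ ^ 2 • (1 : Matrix (Fin n) (Fin n) ℝ))
  have := measurable_gaussDensity (K + σ ^ 2 • (1 : Matrix (Fin n) (Fin n) ℝ))
  unfold channelDensity
  fun_prop

/-- The joint law of a Gaussian signal and its observation in independent Gaussian noise. -/
def channelLaw (K : Matrix (Fin n) (Fin n) ℝ) (σ : ℝ) :
    Measure (EuclideanSpace ℝ (Fin n) × EuclideanSpace ℝ (Fin n)) :=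
  ((multivariateGaussian 0 K).prod
    (multivariateGaussian 0 (σ ^ 2 • (1 : Matrix (Fin n) (Fin n) ℝ)))).map
      fun u => (u.1, u.1 + u.2)

theorem fst_channelLaw : (channelLaw K σ).fst = multivariateGaussian 0 K := by
  rw [channelLaw, Measure.fst, Measure.map_map (by fun_prop) (by fun_prop)]
  exact Measure.fst_prod

theorem snd_channelLaw (hK : K.PosSemidef) (hσ : 0 < σ) :
    (channelLaw K σ).snd =
      multivariateGaussian 0 (K + σ ^ 2 • (1 : Matrix (Fin n) (Fin n) ℝ)) := by
  rw [channelLaw, Measure.snd, Measure.map_map (by fun_prop) (by fun_prop),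
    ← conv_multivariateGaussian hK (posDef_sq_smul_one hσ).posSemidef]
  rfl

/-- Given the signal `f`, the observation has law `N(f, σ² I)`, which has a density with respect to
the marginal law of the observation. No invertibility of `K` is needed. -/
theorem channelLaw_eq_withDensity (hK : K.PosSemidef) (hσ : 0 < σ) :
    channelLaw K σ =
      ((multivariateGaussian 0 K).prod
        (multivariateGaussian 0 (K + σ ^ 2 • (1 : Matrix (Fin n) (Fin n) ℝ)))).withDensity
          fun u => ENNReal.ofReal (channelDensity K σ u) := by
  have hN := posDef_sq_smul_one (n := n) hσ
  have hM := PosDef.posSemidef_add hK hN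
  have hmN := measurable_gaussDensity (σ ^ 2 • (1 : Matrix (Fin n) (Fin n) ℝ))
  have hmM := measurable_gaussDensity (K + σ ^ 2 • (1 : Matrix (Fin n) (Fin n) ℝ))
  have hmr := measurable_channelDensity (K := K) (σ := σ)
  refine Measure.ext_of_lintegral _ fun h hh => ?_
  rw [lintegral_withDensity_eq_lintegral_mul _ hmr.ennreal_ofReal hh, channelLaw,
    lintegral_map hh (by fun_prop), lintegral_prod _ (by fun_prop), lintegral_prod _ (by fun_prop)]
  refine lintegral_congr fun x => ?_
  rw [multivariateGaussian_eq_withDensity hM, multivariateGaussian_eq_withDensity hN,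
    lintegral_withDensity_eq_lintegral_mul _ hmM.ennreal_ofReal (by fun_prop),
    lintegral_withDensity_eq_lintegral_mul _ hmN.ennreal_ofReal (by fun_prop),
    ← lintegral_sub_right_eq_self _ x]
  refine lintegral_congr fun y => ?_
  simp only [Pi.mul_apply, channelDensity, ← mul_assoc]
  rw [← ENNReal.ofReal_mul (gaussDensity_pos hM y).le,
    mul_div_cancel₀ _ (gaussDensity_pos hM y).ne', add_sub_cancel]

theorem log_channelDensity (hK : K.PosSemidef) (hσ : 0 < σ)
    (u : EuclideanSpace ℝ (Fin n) × EuclideanSpace ℝ (Fin n)) :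
    Real.log (channelDensity K σ u) =
      1 / 2 * Real.log ((K + σ ^ 2 • (1 : Matrix (Fin n) (Fin n) ℝ)).det / (σ ^ 2) ^ n)
      - 1 / 2 * ((u.2 - u.1) ⬝ᵥ (σ ^ 2 • (1 : Matrix (Fin n) (Fin n) ℝ))⁻¹ *ᵥ (u.2 - u.1))
      + 1 / 2 * (u.2 ⬝ᵥ (K + σ ^ 2 • (1 : Matrix (Fin n) (Fin n) ℝ))⁻¹ *ᵥ u.2) := by
  have hN := posDef_sq_smul_one (n := n) hσ
  have hM := PosDef.posSemidef_add hK hN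
  have hdet : (σ ^ 2 • (1 : Matrix (Fin n) (Fin n) ℝ)).det = (σ ^ 2) ^ n := by simp
  have h1 := hN.det_pos
  have h2 := hM.det_pos
  have h3 : (0 : ℝ) < (2 * Real.pi) ^ ((n : ℝ) / 2) := by positivity
  rw [← hdet, channelDensity, Real.log_div (gaussDensity_pos hN _).ne' (gaussDensity_pos hM _).ne',
    Real.log_div h2.ne' h1.ne']
  simp only [gaussDensity]
  rw [Real.log_mul (by positivity) (by positivity), Real.log_mul (by positivity) (by positivity),
    Real.log_mul (by positivity) (by positivity), Real.log_mul (by positivity) (by positivity),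
    Real.log_exp, Real.log_exp, Real.log_inv (√_), Real.log_inv (√_), Real.log_sqrt h1.le,
    Real.log_sqrt h2.le]
  simp only [WithLp.ofLp_sub]
  ring

instance isProbabilityMeasure_channelLaw : IsProbabilityMeasure (channelLaw K σ) :=
  Measure.isProbabilityMeasure_map (by fun_prop)

/-- The mutual information of a Gaussian channel is `½ log det (I + σ⁻² K)`: the two quadratic forms
in the log-density both have expectation `n` and cancel. -/
theorem mutualInfo_channelLaw (hK : K.PosSemidef) (hσ : 0 < σ) :
    mutualInfo (channelLaw K σ) = ENNReal.ofReal
      (1 / 2 * Real.log ((K + σ ^ 2 • (1 : Matrix (Fin n) (Fin n) ℝ)).det / (σ ^ 2) ^ n)) := by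
  have hN := posDef_sq_smul_one (n := n) hσ
  have hM := PosDef.posSemidef_add hK hN
  have hmr := measurable_channelDensity (K := K) (σ := σ)
  rw [mutualInfo, fst_channelLaw, snd_channelLaw hK hσ]
  set Q := (multivariateGaussian 0 K).prod
    (multivariateGaussian 0 (K + σ ^ 2 • (1 : Matrix (Fin n) (Fin n) ℝ))) with hQ
  set P := channelLaw K σ with hP
  have hPQ : P = Q.withDensity fun u => ENNReal.ofReal (channelDensity K σ u) :=
    channelLaw_eq_withDensity hK hσ
  have hac : P ≪ Q := hPQ ▸ withDensity_absolutelyContinuous _ _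
  have hllr : llr P Q =ᵐ[P] fun u => Real.log (channelDensity K σ u) := by
    have h := Measure.rnDeriv_withDensity Q hmr.ennreal_ofReal
    rw [← hPQ] at h
    filter_upwards [hac.ae_le h] with u hu
    rw [llr, hu, ENNReal.toReal_ofReal]
    exact (div_pos (gaussDensity_pos hN _) (gaussDensity_pos hM _)).le
  have hm1 := measurable_quadratic (σ ^ 2 • (1 : Matrix (Fin n) (Fin n) ℝ))⁻¹
  have hm2 := measurable_quadratic (K + σ ^ 2 • (1 : Matrix (Fin n) (Fin n) ℝ))⁻¹
  -- the noise `y - f` and the observation `y` have laws `N(0, σ² I)` and `N(0, K + σ² I)`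
  have hlaw1 : P.map (fun u => u.2 - u.1) =
      multivariateGaussian 0 (σ ^ 2 • (1 : Matrix (Fin n) (Fin n) ℝ)) := by
    rw [hP, channelLaw, Measure.map_map (by fun_prop) (by fun_prop)]
    refine Eq.trans ?_ (Measure.snd_prod (μ := multivariateGaussian 0 K))
    rw [Measure.snd]
    congr 1
    ext1 u
    simp
  have hlaw2 : P.map (fun u => u.2) =
      multivariateGaussian 0 (K + σ ^ 2 • (1 : Matrix (Fin n) (Fin n) ℝ)) :=
    snd_channelLaw hK hσ
  have hi1 : Integrable (fun u : EuclideanSpace ℝ (Fin n) × EuclideanSpace ℝ (Fin n) =>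
      (u.2 - u.1) ⬝ᵥ (σ ^ 2 • (1 : Matrix (Fin n) (Fin n) ℝ))⁻¹ *ᵥ (u.2 - u.1)) P := by
    have h := integrable_quadratic
      (multivariateGaussian 0 (σ ^ 2 • (1 : Matrix (Fin n) (Fin n) ℝ)))
      (σ ^ 2 • (1 : Matrix (Fin n) (Fin n) ℝ))⁻¹
    rw [← hlaw1] at h
    exact h.comp_measurable (by fun_prop)
  have hi2 : Integrable (fun u : EuclideanSpace ℝ (Fin n) × EuclideanSpace ℝ (Fin n) =>
      u.2 ⬝ᵥ (K + σ ^ 2 • (1 : Matrix (Fin n) (Fin n) ℝ))⁻¹ *ᵥ u.2) P := by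
    have h := integrable_quadratic
      (multivariateGaussian 0 (K + σ ^ 2 • (1 : Matrix (Fin n) (Fin n) ℝ)))
      (K + σ ^ 2 • (1 : Matrix (Fin n) (Fin n) ℝ))⁻¹
    rw [← hlaw2] at h
    exact h.comp_measurable (by fun_prop)
  have hv1 : ∫ u, (u.2 - u.1) ⬝ᵥ (σ ^ 2 • (1 : Matrix (Fin n) (Fin n) ℝ))⁻¹ *ᵥ (u.2 - u.1) ∂P
      = n := by
    have h := integral_quadratic_inv hN
    rw [← hlaw1, integral_map (by fun_prop) hm1.aestronglyMeasurable] at h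
    exact h
  have hv2 : ∫ u, u.2 ⬝ᵥ (K + σ ^ 2 • (1 : Matrix (Fin n) (Fin n) ℝ))⁻¹ *ᵥ u.2 ∂P = n := by
    have h := integral_quadratic_inv hM
    rw [← hlaw2, integral_map (by fun_prop) hm2.aestronglyMeasurable] at h
    exact h
  simp only [log_channelDensity hK hσ] at hllr
  have hint := ((integrable_const (μ := P) (1 / 2 * Real.log
    ((K + σ ^ 2 • (1 : Matrix (Fin n) (Fin n) ℝ)).det / (σ ^ 2) ^ n))).sub
      (hi1.const_mul (1 / 2))).add (hi2.const_mul (1 / 2))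
  rw [InformationTheory.klDiv_of_ac_of_integrable hac (hint.congr hllr.symm),
    integral_congr_ae hllr, integral_add ?_ (hi2.const_mul (1 / 2)),
    integral_sub (integrable_const _) (hi1.const_mul (1 / 2)), integral_const_mul (1 / 2 : ℝ),
    integral_const_mul (1 / 2 : ℝ), integral_const_mul (1 / 2 : ℝ), hv1, hv2]
  · simp
  · exact (integrable_const _).sub (hi1.const_mul (1 / 2))

end

theorem mutualInfo_gpObsLaw {α : Type} {k : α → α → ℝ} {σ : ℝ} (hk : IsPSDKernel k) (hσ : 0 < σ)
    {n : ℕ} (p : Fin n → α) : mutualInfo (gpObsLaw k σ p) =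
      ENNReal.ofReal (1 / 2 * Real.log ((ridgeGram k σ p).det / (σ ^ 2) ^ n)) :=
  mutualInfo_channelLaw (hk p) hσ

/-! ### Information gain and greedy uncertainty sampling -/

section
variable {α : Type} {k : α → α → ℝ} {σ : ℝ}

/-- The information gain `½ log det (I + σ⁻² K)` of a sequence of sampling points. -/
def infoGain (k : α → α → ℝ) (σ : ℝ) {n : ℕ} (p : Fin n → α) : ℝ :=
  1 / 2 * Real.log ((ridgeGram k σ p).det / (σ ^ 2) ^ n)

theorem infoGain_zero (p : Fin 0 → α) : infoGain k σ p = 0 := by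
  simp [infoGain]

theorem IsPSDKernel.infoGain_snoc (hk : IsPSDKernel k) (hσ : 0 < σ) {n : ℕ} (p : Fin n → α)
    (a : α) : infoGain k σ (Fin.snoc p a : Fin (n + 1) → α) =
      infoGain k σ p + 1 / 2 * Real.log (1 + postVar k σ p a / σ ^ 2) := by
  have h1 := (hk.posDef_ridgeGram hσ p).det_pos
  have h2 := hk.postVar_nonneg hσ p a
  rw [infoGain, infoGain, ← mul_add, ← Real.log_mul (by positivity) (by positivity),
    hk.det_ridgeGram_snoc hσ]
  congr 2
  field_simp
  ring

variable [Finite α]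

/-- On a finite domain the supremum defining `maxInfoGain` is finite, so that its real value is not
a junk value. -/
theorem iSup_mutualInfo_ne_top (hk : IsPSDKernel k) (hσ : 0 < σ) (t : ℕ) :
    ⨆ p : Fin t → α, mutualInfo (gpObsLaw k σ p) ≠ ⊤ := by
  obtain ⟨C, hC⟩ := Finite.bddAbove_range fun p : Fin t → α => infoGain k σ p
  refine ((iSup_le fun p => ?_).trans_lt (ENNReal.ofReal_lt_top (r := C))).ne
  rw [mutualInfo_gpObsLaw hk hσ]
  exact ENNReal.ofReal_le_ofReal (hC ⟨p, rfl⟩)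

theorem IsPSDKernel.infoGain_le (hk : IsPSDKernel k) (hσ : 0 < σ) {t : ℕ} (p : Fin t → α) :
    infoGain k σ p ≤ maxInfoGain k σ t := by
  rw [maxInfoGain, ← ENNReal.ofReal_le_iff_le_toReal (iSup_mutualInfo_ne_top hk hσ t)]
  refine le_trans (le_of_eq ?_) (le_iSup _ p)
  rw [mutualInfo_gpObsLaw hk hσ]
  rfl

theorem IsPSDKernel.maxInfoGain_mono [Nonempty α] (hk : IsPSDKernel k) (hσ : 0 < σ) :
    Monotone (maxInfoGain k σ) := by
  refine monotone_nat_of_le_succ fun t => ?_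
  refine ENNReal.toReal_mono (iSup_mutualInfo_ne_top hk hσ _) (iSup_le fun p => ?_)
  have a : α := Classical.arbitrary α
  refine le_trans ?_ (le_iSup _ (Fin.snoc p a : Fin (t + 1) → α))
  rw [mutualInfo_gpObsLaw hk hσ, mutualInfo_gpObsLaw hk hσ]
  refine ENNReal.ofReal_le_ofReal ?_
  change infoGain k σ p ≤ infoGain k σ _
  rw [hk.infoGain_snoc hσ]
  have := hk.postVar_nonneg hσ p a
  have : 0 ≤ Real.log (1 + postVar k σ p a / σ ^ 2) :=
    Real.log_nonneg (le_add_of_nonneg_right (by positivity))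
  linarith

theorem IsPSDKernel.le_maxInfoGain_one [Nonempty α] (hk : IsPSDKernel k) (hσ : 0 < σ)
    (hdiag : ∀ x, k x x = 1) : 1 / 2 * Real.log (1 + 1 / σ ^ 2) ≤ maxInfoGain k σ 1 := by
  have a : α := Classical.arbitrary α
  have h := hk.infoGain_le hσ (Fin.snoc (Fin.elim0 : Fin 0 → α) a : Fin 1 → α)
  rwa [hk.infoGain_snoc hσ, infoGain_zero, postVar_zero, hdiag, zero_add] at h
end

section
variable {α : Type} {k : α → α → ℝ} {σ : ℝ}

theorem IsPSDKernel.postVar_le_diag (hk : IsPSDKernel k) (hσ : 0 < σ) {n : ℕ} (p : Fin n → α)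
    (x : α) : postVar k σ p x ≤ k x x := by
  simpa [powerFun] using hk.postVar_le hσ p 0 x

/-- The posterior variance does not change under a cast of the index type, as needed to pass from
lists to finite sequences. -/
theorem postVar_congr {n m : ℕ} (h : n = m) {p : Fin n → α} {p' : Fin m → α}
    (hp : ∀ i, p i = p' (Fin.cast h i)) (x : α) : postVar k σ p x = postVar k σ p' x := by
  subst h
  rw [show p = p' from funext hp]

theorem infoGain_congr {n m : ℕ} (h : n = m) {p : Fin n → α} {p' : Fin m → α}
    (hp : ∀ i, p i = p' (Fin.cast h i)) : infoGain k σ p = infoGain k σ p' := by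
  subst h
  rw [show p = p' from funext hp]

theorem get_append_singleton (S : List α) (a : α) (i : Fin (S ++ [a]).length) :
    (S ++ [a]).get i = (Fin.snoc S.get a : Fin (S.length + 1) → α) (Fin.cast (by simp) i) := by
  obtain ⟨i, hi⟩ := i
  have hi' : i < S.length + 1 := by simpa using hi
  rcases Nat.lt_succ_iff_lt_or_eq.1 hi' with h | h
  · have : Fin.cast (by simp) (⟨i, hi⟩ : Fin (S ++ [a]).length) = Fin.castSucc ⟨i, h⟩ := rfl
    rw [this, Fin.snoc_castSucc]
    simp [h]
  · subst h
    have : Fin.cast (by simp) (⟨S.length, hi⟩ : Fin (S ++ [a]).length) = Fin.last S.length := rfl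
    rw [this, Fin.snoc_last]
    simp

theorem length_bpeBatch (tie : List α → Finset α → α) (q : List α) (A : Finset α) (j : ℕ) :
    (bpeBatch k σ tie q A j).length = j := by
  induction j with
  | zero => rfl
  | succ j ih => simp [bpeBatch, ih]

theorem maxStdSet_nonempty (S : List α) {A : Finset α} (hA : A.Nonempty) :
    (maxStdSet k σ S A).Nonempty := by
  obtain ⟨x, hx, h⟩ := A.exists_max_image (postStd k σ S.get) hA
  exact ⟨x, by simpa [maxStdSet] using ⟨hx, h⟩⟩

theorem bpeBatch_subset {tie : List α → Finset α → α} (htie : IsTieBreak tie) (q : List α)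
    {A : Finset α} (hA : A.Nonempty) (j : ℕ) : ∀ x ∈ bpeBatch k σ tie q A j, x ∈ A := by
  induction j with
  | zero => simp [bpeBatch]
  | succ j ih =>
    intro x hx
    rw [bpeBatch, List.mem_append, List.mem_singleton] at hx
    rcases hx with hx | rfl
    · exact ih x hx
    · have := htie (q ++ bpeBatch k σ tie q A j) _
        (maxStdSet_nonempty (k := k) (σ := σ) (bpeBatch k σ tie q A j) hA)
      simp only [maxStdSet, Finset.mem_filter] at this
      exact this.1

/-- Concavity of the logarithm, as the bound `v log (1 + 1/s) ≤ log (1 + v/s)` on `[0, 1]`. -/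
theorem mul_log_le_log_one_add {s v : ℝ} (hs : 0 < s) (h0 : 0 ≤ v) (h1 : v ≤ 1) :
    v * Real.log (1 + 1 / s) ≤ Real.log (1 + v / s) := by
  have h := rpow_one_add_le_one_add_mul_self (s := 1 / s) (by
    have : 0 < 1 / s := by positivity
    linarith) h0 h1
  have hpos : 0 < 1 + 1 / s := by positivity
  rw [← Real.log_rpow hpos]
  refine Real.log_le_log (by positivity) (h.trans (le_of_eq ?_))
  ring

/-- Greedy uncertainty sampling: after `j` points the posterior variance is, everywhere on the
active set, at most the average of the variances at the chosen points, which the information gain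
controls. -/
theorem IsPSDKernel.mul_postVar_bpeBatch_le (hk : IsPSDKernel k) (hσ : 0 < σ)
    (hdiag : ∀ x, k x x = 1) {tie : List α → Finset α → α} (htie : IsTieBreak tie) (q : List α)
    {A : Finset α} {x : α} (hx : x ∈ A) (j : ℕ) :
    j * postVar k σ (bpeBatch k σ tie q A j).get x * Real.log (1 + 1 / σ ^ 2) ≤
      2 * infoGain k σ (bpeBatch k σ tie q A j).get := by
  induction j with
  | zero => simp [bpeBatch, infoGain_zero]
  | succ j ih =>
    set S := bpeBatch k σ tie q A j with hS
    set a := tie (q ++ S) (maxStdSet k σ S A) with ha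
    have haS : a ∈ maxStdSet k σ S A := htie _ _ (maxStdSet_nonempty S ⟨x, hx⟩)
    have hmax : postVar k σ S.get x ≤ postVar k σ S.get a := by
      simp only [maxStdSet, Finset.mem_filter] at haS
      exact (Real.sqrt_le_sqrt_iff (hk.postVar_nonneg hσ _ _)).1 (haS.2 x hx)
    rw [show bpeBatch k σ tie q A (j + 1) = S ++ [a] from rfl,
      postVar_congr (by simp) (get_append_singleton S a),
      infoGain_congr (by simp) (get_append_singleton S a), hk.infoGain_snoc hσ]
    have h1 := hk.postVar_snoc_le hσ S.get a x
    have h2 := mul_log_le_log_one_add (s := σ ^ 2) (by positivity) (hk.postVar_nonneg hσ S.get a)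
      ((hk.postVar_le_diag hσ S.get a).trans (hdiag a).le)
    have hlog : 0 ≤ Real.log (1 + 1 / σ ^ 2) :=
      Real.log_nonneg (le_add_of_nonneg_right (by positivity))
    have h3 : ((j + 1 : ℕ) : ℝ) * postVar k σ (Fin.snoc S.get a : Fin (S.length + 1) → α) x ≤
        j * postVar k σ S.get x + postVar k σ S.get a := by
      push_cast
      nlinarith [Nat.cast_nonneg (α := ℝ) j]
    have h4 := mul_le_mul_of_nonneg_right h3 hlog
    rw [add_mul] at h4
    linarith

end

/-! ### Tails of Gaussian linear forms -/

/-- Shifting a set of the half-line on the side of `c` outwards by `c` costs a factor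
`exp (-c²/2)` of Gaussian mass. -/
theorem gaussianReal_preimage_sub_le (c : ℝ) {A : Set ℝ} (hA : MeasurableSet A)
    (hc : ∀ x ∈ A, 0 ≤ c * x) :
    gaussianReal 0 1 {x | x - c ∈ A} ≤
      ENNReal.ofReal (Real.exp (-c ^ 2 / 2)) * gaussianReal 0 1 A := by
  have hA' : MeasurableSet {x : ℝ | x - c ∈ A} := hA.preimage (by fun_prop)
  rw [gaussianReal_apply _ one_ne_zero, gaussianReal_apply _ one_ne_zero,
    ← lintegral_indicator hA', ← lintegral_indicator hA,
    ← lintegral_const_mul _ ((measurable_gaussianPDF 0 1).indicator hA),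
    ← lintegral_add_right_eq_self _ c]
  refine lintegral_mono fun x => ?_
  by_cases hx : x ∈ A
  · have hx' : x + c ∈ {x | x - c ∈ A} := by simpa using hx
    rw [Set.indicator_of_mem hx', Set.indicator_of_mem hx, gaussianPDF, gaussianPDF,
      ← ENNReal.ofReal_mul (Real.exp_nonneg _)]
    refine ENNReal.ofReal_le_ofReal ?_
    simp only [gaussianPDFReal, NNReal.coe_one, mul_one, sub_zero]
    rw [mul_left_comm, ← Real.exp_add]
    have := hc x hx
    gcongr
    nlinarith
  · have hx' : x + c ∉ {x | x - c ∈ A} := by simpa using hx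
    simp [hx', hx]

/-- The two-sided tail bound `P(|Z| > u) ≤ exp (-u²/2)` for a standard Gaussian, without the factor
`2` of the Chernoff bound: shifting each tail to the origin loses only `exp (-u²/2)`. -/
theorem gaussianReal_abs_gt_le {u : ℝ} (hu : 0 ≤ u) :
    gaussianReal 0 1 {x | u < |x|} ≤ ENNReal.ofReal (Real.exp (-u ^ 2 / 2)) := by
  have h1 := gaussianReal_preimage_sub_le u (measurableSet_Ioi (a := (0 : ℝ)))
    fun x hx => mul_nonneg hu (le_of_lt hx)
  have h2 := gaussianReal_preimage_sub_le (-u) (measurableSet_Iio (a := (0 : ℝ)))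
    fun x hx => by have : x < 0 := hx; nlinarith
  rw [neg_sq] at h2
  have hsub : {x : ℝ | u < |x|} ⊆ {x | x - u ∈ Set.Ioi 0} ∪ {x | x - -u ∈ Set.Iio 0} := by
    intro x hx
    rcases lt_abs.1 (show u < |x| from hx) with h | h
    · left; simpa using h
    · right
      simp only [Set.mem_Iio, Set.mem_ofPred_eq]
      linarith
  calc _ ≤ _ := (measure_mono hsub).trans (measure_union_le _ _)
    _ ≤ _ := add_le_add h1 h2
    _ = ENNReal.ofReal (Real.exp (-u ^ 2 / 2)) *
        gaussianReal 0 1 (Set.Ioi 0 ∪ Set.Iio 0) := by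
      rw [measure_union _ measurableSet_Iio, mul_add]
      exact Set.disjoint_left.2 fun x (h : 0 < x) (h' : x < 0) => lt_asymm h h'
    _ ≤ _ := mul_le_of_le_one_right (by simp) prob_le_one

theorem gaussianReal_abs_gt_mul_sqrt_le {u : ℝ} (hu : 0 ≤ u) (v : NNReal) :
    gaussianReal 0 v {x | u * √v < |x|} ≤ ENNReal.ofReal (Real.exp (-u ^ 2 / 2)) := by
  rcases eq_or_ne v 0 with rfl | hv
  · simp [gaussianReal_zero_var]
  · have hpos : 0 < √(v : ℝ) := Real.sqrt_pos.2 (by positivity)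
    have hmap : gaussianReal 0 v = (gaussianReal 0 1).map (fun x => √(v : ℝ) * x) := by
      rw [gaussianReal_map_const_mul]
      congr 1
      · simp
      · ext; simp
    rw [hmap, Measure.map_apply (by fun_prop) (measurableSet_lt measurable_const (by fun_prop))]
    refine (measure_mono fun x hx => ?_).trans (gaussianReal_abs_gt_le hu)
    simp only [Set.mem_preimage, Set.mem_ofPred_eq, abs_mul, abs_of_pos hpos] at hx ⊢
    rw [mul_comm] at hx
    exact lt_of_mul_lt_mul_left hx hpos.le

section
variable {Ω : Type u} [MeasurableSpace Ω] {P : Measure Ω}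
  {z : ℕ → Ω → ℝ} {σ : ℝ}

theorem map_linearForm_noise (hz : ∀ t, Measurable (z t)) (hind : iIndepFun z P)
    (hlaw : ∀ t, P.map (z t) = gaussianReal 0 (σ ^ 2).toNNReal) (t : ℕ) {n : ℕ} (w : Fin n → ℝ) :
    P.map (fun ω => ∑ j, w j * z (t + j) ω) =
      gaussianReal 0 (σ ^ 2 * (w ⬝ᵥ w)).toNNReal := by
  set X : Fin n → Ω → ℝ := fun j ω => w j * z (t + j) ω with hX
  have hmeas : ∀ j, Measurable (X j) := fun j => (hz _).const_mul _
  have hXlaw : ∀ j, P.map (X j) = gaussianReal 0 (w j ^ 2 * σ ^ 2).toNNReal := by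
    intro j
    have := gaussianReal_map_const_mul (μ := 0) (v := (σ ^ 2).toNNReal) (w j)
    rw [← hlaw (t + j), Measure.map_map (by fun_prop) (hz _), mul_zero] at this
    refine this.trans (congrArg _ (NNReal.eq ?_))
    rw [Real.coe_toNNReal _ (by positivity)]
    exact congrArg (w j ^ 2 * ·) (Real.coe_toNNReal _ (sq_nonneg σ))
  have hind' : iIndepFun X P := by
    have h1 : iIndepFun (fun j : Fin n => z (t + j)) P :=
      hind.precomp (g := fun j : Fin n => t + (j : ℕ)) fun a b h => by
        simpa [Fin.ext_iff] using h
    exact h1.comp (fun j x => w j * x) fun j => by fun_prop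
  have hg : ∀ j, HasGaussianLaw (X j) P := fun j =>
    ⟨by rw [hXlaw]; infer_instance⟩
  have hsum := (hind'.hasGaussianLaw_fun_sum hg).map_eq_gaussianReal
  have hmean : ∀ j, ∫ ω, X j ω ∂P = 0 := fun j => by
    rw [← integral_map (hmeas j).aemeasurable (f := fun x => x) (by fun_prop), hXlaw]
    exact integral_id_gaussianReal
  have hvar : ∀ j, Var[X j; P] = w j ^ 2 * σ ^ 2 := fun j => by
    have h : Var[id; P.map (X j)] = Var[X j; P] := by
      rw [variance_map (by fun_prop) (hmeas j).aemeasurable]; rfl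
    rw [← h, hXlaw, variance_id_gaussianReal, Real.coe_toNNReal _ (by positivity)]
  have hV : Var[fun ω => ∑ j, X j ω; P] = σ ^ 2 * (w ⬝ᵥ w) := by
    have h := IndepFun.variance_sum (s := Finset.univ) (X := X) (μ := P)
      (fun j _ => (hg j).memLp_two) fun i _ j _ hij => hind'.indepFun hij
    rw [show (fun ω => ∑ j, X j ω) = ∑ j, X j by ext ω; simp, h]
    simp only [hvar, dotProduct, Finset.mul_sum]
    exact Finset.sum_congr rfl fun j _ => by ring
  rw [hsum, hV, integral_finsetSum _ fun j _ => (hg j).integrable]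
  simp [hmean]

theorem measure_linearForm_noise_le (hσ : 0 < σ) (hz : ∀ t, Measurable (z t)) (hind : iIndepFun z P)
    (hlaw : ∀ t, P.map (z t) = gaussianReal 0 (σ ^ 2).toNNReal) (t : ℕ) {n : ℕ} (w : Fin n → ℝ)
    {u : ℝ} (hu : 0 ≤ u) :
    P {ω | u * (σ * √(w ⬝ᵥ w)) < |∑ j, w j * z (t + j) ω|} ≤
      ENNReal.ofReal (Real.exp (-u ^ 2 / 2)) := by
  have hw : 0 ≤ w ⬝ᵥ w := Finset.sum_nonneg fun i _ => mul_self_nonneg _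
  have hm : Measurable fun ω => ∑ j, w j * z (t + j) ω := by fun_prop
  have h := gaussianReal_abs_gt_mul_sqrt_le hu (σ ^ 2 * (w ⬝ᵥ w)).toNNReal
  rw [← map_linearForm_noise hz hind hlaw t w, Measure.map_apply hm
    (measurableSet_lt measurable_const (by fun_prop)),
    Real.coe_toNNReal _ (by positivity), Real.sqrt_mul (sq_nonneg _), Real.sqrt_sq hσ.le] at h
  exact h

end

/-! ### The confidence event -/

section
variable {α : Type} {k : α → α → ℝ} {σ β : ℝ} {tie : List α → Finset α → α} {N : ℕ → ℕ} {f : α → ℝ}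

/-- The state of BPE after one more batch of size `n`, from the state `s` and the noise `z`. -/
def bpeStep (k : α → α → ℝ) (σ β : ℝ) (tie : List α → Finset α → α) (n : ℕ) (f : α → ℝ)
    (z : ℕ → ℝ) (s : Finset α × List α) : Finset α × List α :=
  (eliminate k σ β (bpeBatch k σ tie s.2 s.1 n)
    (fun j => f ((bpeBatch k σ tie s.2 s.1 n).get j) + z (s.2.length + j)) s.1,
    s.2 ++ bpeBatch k σ tie s.2 s.1 n)

variable [Fintype α]

theorem bpeState_succ (z : ℕ → ℝ) (i : ℕ) : bpeState k σ β tie N f z (i + 1) =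
    bpeStep k σ β tie (N (i + 1)) f z (bpeState k σ β tie N f z i) := rfl

theorem length_bpeState (z : ℕ → ℝ) (i : ℕ) :
    (bpeState k σ β tie N f z i).2.length = ∑ j ∈ Finset.range i, N (j + 1) := by
  induction i with
  | zero => rfl
  | succ i ih => rw [bpeState_succ, Finset.sum_range_succ, ← ih]; simp [bpeStep, length_bpeBatch]

/-- The state after `i` batches depends only on the noise in these batches. -/
theorem bpeState_congr {z z' : ℕ → ℝ} (i : ℕ)
    (h : ∀ t < ∑ j ∈ Finset.range i, N (j + 1), z t = z' t) :
    bpeState k σ β tie N f z i = bpeState k σ β tie N f z' i := by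
  induction i with
  | zero => rfl
  | succ i ih =>
    rw [Finset.sum_range_succ] at h
    rw [bpeState_succ, bpeState_succ, ← ih fun t ht => h t (by omega), bpeStep, bpeStep]
    congr 2
    ext j
    have hj := j.2
    have hl := length_bpeBatch (k := k) (σ := σ) tie (bpeState k σ β tie N f z i).2
      (bpeState k σ β tie N f z i).1 (N (i + 1))
    rw [h _ (by rw [length_bpeState]; omega)]

omit [Fintype α] in
theorem measurable_postMean {n : ℕ} (p : Fin n → α) (x : α) {ι : Type} [MeasurableSpace ι]
    {y : ι → Fin n → ℝ} (hy : ∀ j, Measurable fun z => y z j) :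
    Measurable fun z => postMean k σ p (y z) x := by
  simp only [postMean, dotProduct, mulVec]
  fun_prop

theorem measurableSet_bpeStep (n : ℕ) (s s' : Finset α × List α) :
    MeasurableSet {z : ℕ → ℝ | bpeStep k σ β tie n f z s = s'} := by
  set S := bpeBatch k σ tie s.2 s.1 n with hS
  have hmean : ∀ x, Measurable fun z : ℕ → ℝ =>
      postMean k σ S.get (fun j => f (S.get j) + z (s.2.length + j)) x := fun x =>
    measurable_postMean S.get x fun j => by fun_prop
  have hset : {z : ℕ → ℝ | bpeStep k σ β tie n f z s = s'} =
      {z | (∀ x, (x ∈ s.1 ∧ ∀ x' ∈ s.1,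
        lcb k σ β S (fun j => f (S.get j) + z (s.2.length + j)) x' ≤
          ucb k σ β S (fun j => f (S.get j) + z (s.2.length + j)) x) ↔ x ∈ s'.1) ∧
        s.2 ++ S = s'.2} := by
    ext z
    simp only [bpeStep, ← hS, Set.mem_ofPred_eq, Prod.ext_iff, Finset.ext_iff, eliminate,
      Finset.mem_filter]
    rfl
  rw [hset]
  refine measurableSet_setOfPred.2 (Measurable.and (Measurable.forall fun x => ?_) measurable_const)
  refine Measurable.iff (measurable_const.and ?_) measurable_const
  refine Measurable.forall fun x' => measurable_const.imp (measurableSet_setOfPred.1 ?_)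
  unfold lcb ucb
  exact measurableSet_le ((hmean x').sub_const _) ((hmean x).add_const _)

theorem measurableSet_bpeState (i : ℕ) (s : Finset α × List α) :
    MeasurableSet {z : ℕ → ℝ | bpeState k σ β tie N f z i = s} := by
  induction i generalizing s with
  | zero => exact MeasurableSet.const ((Finset.univ, []) = s)
  | succ i ih =>
    have : {z : ℕ → ℝ | bpeState k σ β tie N f z (i + 1) = s} =
        ⋃ s', {z | bpeState k σ β tie N f z i = s'} ∩
          {z | bpeStep k σ β tie (N (i + 1)) f z s' = s} := by
      ext z; simp [bpeState_succ]
    rw [this]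
    exact MeasurableSet.iUnion fun s' => (ih s').inter (measurableSet_bpeStep _ _ _)

/-- The points queried in batch `i + 1`. -/
def batchPoints (k : α → α → ℝ) (σ β : ℝ) (tie : List α → Finset α → α) (N : ℕ → ℕ) (f : α → ℝ)
    (z : ℕ → ℝ) (i : ℕ) : List α :=
  bpeBatch k σ tie (bpeState k σ β tie N f z i).2 (bpeState k σ β tie N f z i).1 (N (i + 1))

/-- The answers to the queries of batch `i + 1`. -/
def batchAnswers (k : α → α → ℝ) (σ β : ℝ) (tie : List α → Finset α → α) (N : ℕ → ℕ) (f : α → ℝ)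
    (z : ℕ → ℝ) (i : ℕ) : Fin (batchPoints k σ β tie N f z i).length → ℝ := fun j =>
  f ((batchPoints k σ β tie N f z i).get j) + z ((bpeState k σ β tie N f z i).2.length + j)

variable {Ω : Type u} [MeasurableSpace Ω] {P : Measure Ω} [IsProbabilityMeasure P] {z : ℕ → Ω → ℝ}

/-- The event that the confidence interval at `x` computed after batch `i + 1` misses `f x`. -/
def missEvent (k : α → α → ℝ) (σ β : ℝ) (tie : List α → Finset α → α) (N : ℕ → ℕ) (f : α → ℝ)
    (z : ℕ → Ω → ℝ) (i : ℕ) (x : α) : Set Ω :=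
  {ω | √β * postStd k σ (batchPoints k σ β tie N f (fun t => z t ω) i).get x <
    |f x - postMean k σ (batchPoints k σ β tie N f (fun t => z t ω) i).get
      (batchAnswers k σ β tie N f (fun t => z t ω) i) x|}

omit [Fintype α] in
/-- The error of the posterior mean splits into a bias, at most `Ψ` times the power function, and a
linear form in the noise. Both are controlled by the posterior variance, so a confidence interval
can only fail if the noise term is large. -/
theorem RKHSNormLE.noise_gt_of_miss {Ψ u : ℝ} (hf : RKHSNormLE k f Ψ) (hΨ : 0 ≤ Ψ) (hu : 0 ≤ u)
    (hσ : 0 < σ) {n : ℕ} (p : Fin n → α) (e : Fin n → ℝ) (x : α)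
    (h : (Ψ + u) * postStd k σ p x < |f x - postMean k σ p (fun j => f (p j) + e j) x|) :
    u * (σ * √(ridgeWeights k σ p x ⬝ᵥ ridgeWeights k σ p x)) <
      |∑ j, ridgeWeights k σ p x j * e j| := by
  have hk := hf.isPSDKernel
  set w := ridgeWeights k σ p x with hw
  have h1 := hf.abs_sub_sum_le p w x
  have h2 := hk.powerFun_ridgeWeights hσ p x
  have h3 := hk.powerFun_nonneg p w x
  have hww : 0 ≤ w ⬝ᵥ w := Finset.sum_nonneg fun i _ => mul_self_nonneg _
  have h4 : √(powerFun k p w x) ≤ postStd k σ p x :=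
    Real.sqrt_le_sqrt (by rw [← h2]; exact le_add_of_nonneg_right (by positivity))
  have h5 : σ * √(w ⬝ᵥ w) ≤ postStd k σ p x := by
    rw [← Real.sqrt_sq hσ.le, ← Real.sqrt_mul (sq_nonneg σ), Real.sqrt_sq hσ.le]
    exact Real.sqrt_le_sqrt (by rw [← h2]; exact le_add_of_nonneg_left h3)
  have h6 : f x - postMean k σ p (fun j => f (p j) + e j) x =
      (f x - ∑ j, w j * f (p j)) - ∑ j, w j * e j := by
    rw [hk.postMean_eq hσ]
    simp only [mul_add, Finset.sum_add_distrib]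
    ring
  rw [h6] at h
  have h7 := abs_sub (f x - ∑ j, w j * f (p j)) (∑ j, w j * e j)
  have h8 := mul_le_mul_of_nonneg_left h4 hΨ
  have h9 := mul_le_mul_of_nonneg_left h5 hu
  linarith

/-- A single confidence interval fails with probability at most `exp (-u²/2)`: given the state
before the batch, the noise of the batch is still independent `N(0, σ²)`. -/
theorem measure_missEvent_le {Ψ u : ℝ} (hf : RKHSNormLE k f Ψ) (hΨ : 0 ≤ Ψ) (hu : 0 ≤ u)
    (hβ : √β = Ψ + u) (hσ : 0 < σ) (hz : ∀ t, Measurable (z t)) (hind : iIndepFun z P)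
    (hlaw : ∀ t, P.map (z t) = gaussianReal 0 (σ ^ 2).toNNReal) (i : ℕ) (x : α) :
    P (missEvent k σ β tie N f z i x) ≤ ENNReal.ofReal (Real.exp (-u ^ 2 / 2)) := by
  set t := ∑ j ∈ Finset.range i, N (j + 1) with ht
  let S : Finset α × List α → List α := fun s => bpeBatch k σ tie s.2 s.1 (N (i + 1))
  let w : (s : Finset α × List α) → Fin (S s).length → ℝ := fun s => ridgeWeights k σ (S s).get x
  let E : Finset α × List α → Set Ω := fun s => {ω | bpeState k σ β tie N f (fun t => z t ω) i = s}
  let D : Finset α × List α → Set Ω := fun s =>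
    {ω | u * (σ * √(w s ⬝ᵥ w s)) < |∑ j, w s j * z (t + j) ω|}
  have hzm : Measurable fun ω (t : ℕ) => z t ω := by fun_prop
  have hE : ∀ s, MeasurableSet (E s) := fun s => (measurableSet_bpeState i s).preimage hzm
  have hsub : missEvent k σ β tie N f z i x ⊆ ⋃ s, E s ∩ D s := by
    intro ω hω
    refine Set.mem_iUnion.2 ⟨bpeState k σ β tie N f (fun t => z t ω) i, rfl, ?_⟩
    rw [missEvent, Set.mem_ofPred_eq, hβ] at hω
    have := hf.noise_gt_of_miss hΨ hu hσ _ _ x hω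
    rw [length_bpeState] at this
    exact this
  have hindep : ∀ s, P (E s ∩ D s) = P (E s) * P (D s) := by
    intro s
    have hI := hind.indepFun_finset (Finset.range t) (Finset.Ico t (t + (S s).length))
      (by
        rw [Finset.disjoint_left]
        intro a ha hb
        rw [Finset.mem_range] at ha
        rw [Finset.mem_Ico] at hb
        omega) hz
    let ext : (Finset.range t → ℝ) → ℕ → ℝ := fun v m =>
      if h : m ∈ Finset.range t then v ⟨m, h⟩ else 0
    have hext : Measurable ext := by
      refine measurable_pi_lambda _ fun m => ?_
      by_cases h : m ∈ Finset.range t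
      · simp only [ext, h, dite_true]; fun_prop
      · simp only [ext, h, dite_false]; fun_prop
    have hEs : E s = (fun ω (m : Finset.range t) => z m ω) ⁻¹'
        {v | bpeState k σ β tie N f (ext v) i = s} := by
      ext ω
      simp only [E, Set.mem_ofPred_eq, Set.mem_preimage]
      rw [bpeState_congr i fun m hm => ?_]
      have : m ∈ Finset.range t := Finset.mem_range.2 hm
      simp only [ext, this, dite_true]
    have hmem : ∀ j : Fin (S s).length, t + (j : ℕ) ∈ Finset.Ico t (t + (S s).length) := fun j => by
      have := j.2
      rw [Finset.mem_Ico]; omega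
    have hDs : D s = (fun ω (m : Finset.Ico t (t + (S s).length)) => z m ω) ⁻¹'
        {v | u * (σ * √(w s ⬝ᵥ w s)) < |∑ j, w s j * v ⟨t + j, hmem j⟩|} := rfl
    rw [hEs, hDs]
    exact hI.measure_inter_preimage_eq_mul _ _ ((measurableSet_bpeState i s).preimage hext)
      (measurableSet_lt measurable_const (by fun_prop))
  have hEsum : ∑' s, P (E s) ≤ 1 := by
    rw [← measure_iUnion (fun s s' hss => ?_) hE]
    · exact prob_le_one
    · exact Set.disjoint_left.2 fun ω h h' => hss (h.symm.trans h')
  calc P (missEvent k σ β tie N f z i x) ≤ ∑' s, P (E s ∩ D s) :=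
        (measure_mono hsub).trans (measure_iUnion_le _)
    _ ≤ ∑' s, P (E s) * ENNReal.ofReal (Real.exp (-u ^ 2 / 2)) := by
        refine ENNReal.tsum_le_tsum fun s => ?_
        rw [hindep]
        gcongr
        exact measure_linearForm_noise_le hσ hz hind hlaw t (w s) hu
    _ ≤ _ := by
        rw [ENNReal.tsum_mul_right]
        exact mul_le_of_le_one_left (by simp) hEsum

theorem sqrt_bpeBeta {Ψ δ : ℝ} (hΨ : 0 ≤ Ψ) (n B : ℕ) :
    √(bpeBeta Ψ δ n B) = Ψ + √(2 * Real.log (n * B / δ)) :=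
  Real.sqrt_sq (by positivity)

/-- With probability at least `1 - δ`, all confidence intervals of the first `B` batches hold. -/
theorem one_sub_le_measureReal_confidence {Ψ δ : ℝ} (hf : RKHSNormLE k f Ψ) (hΨ : 0 ≤ Ψ)
    (hσ : 0 < σ) (hδ : 0 < δ) (hδ1 : δ < 1) (hz : ∀ t, Measurable (z t)) (hind : iIndepFun z P)
    (hlaw : ∀ t, P.map (z t) = gaussianReal 0 (σ ^ 2).toNNReal) {B : ℕ} (hB : 0 < B) [Nonempty α]
    {G : Set Ω}
    (hG : ∀ ω, (∀ i < B, ∀ x,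
      ω ∉ missEvent k σ (bpeBeta Ψ δ (Fintype.card α) B) tie N f z i x) → ω ∈ G) :
    1 - δ ≤ P.real G := by
  set β := bpeBeta Ψ δ (Fintype.card α) B with hβ
  set n := Fintype.card α with hn
  have hn0 : 0 < n := Fintype.card_pos
  have hnB : (1 : ℝ) ≤ n * B := by exact_mod_cast Nat.mul_pos hn0 hB
  set u := √(2 * Real.log (n * B / δ)) with hu
  have hlog : 0 ≤ Real.log (n * B / δ) := Real.log_nonneg (by rw [le_div_iff₀ hδ]; linarith)
  have hexp : Real.exp (-u ^ 2 / 2) = δ / (n * B) := by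
    rw [hu, Real.sq_sqrt (by positivity),
      show -(2 * Real.log (n * B / δ)) / 2 = -Real.log (n * B / δ) by ring, Real.exp_neg,
      Real.exp_log (by positivity), inv_div]
  have hmiss : ∀ i x, P.real (missEvent k σ β tie N f z i x) ≤ δ / (n * B) := fun i x => by
    have h := measure_missEvent_le (tie := tie) (N := N) hf hΨ (Real.sqrt_nonneg _)
      (sqrt_bpeBeta (δ := δ) hΨ n B) hσ hz hind hlaw i x
    rw [← hexp]
    exact ENNReal.toReal_le_of_le_ofReal (Real.exp_nonneg _) h
  have hcover : Set.univ ⊆ G ∪ ⋃ i ∈ Finset.range B, ⋃ x ∈ (Finset.univ : Finset α),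
      missEvent k σ β tie N f z i x := by
    intro ω _
    by_contra h
    rw [Set.mem_union, not_or] at h
    refine h.1 (hG ω fun i hi x hx => h.2 ?_)
    simp only [Set.mem_iUnion, Finset.mem_range, Finset.mem_univ, exists_true_left]
    exact ⟨i, hi, x, hx⟩
  have h1 : P.real (⋃ i ∈ Finset.range B, ⋃ x ∈ (Finset.univ : Finset α),
      missEvent k σ β tie N f z i x) ≤ δ :=
    calc _ ≤ ∑ i ∈ Finset.range B, ∑ x : α, δ / (n * B) :=
          (measureReal_biUnion_finset_le _ _).trans (Finset.sum_le_sum fun i _ =>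
            (measureReal_biUnion_finset_le _ _).trans (Finset.sum_le_sum fun x _ => hmiss i x))
      _ = δ := by
          rw [Finset.sum_const, Finset.sum_const, Finset.card_range, Finset.card_univ, ← hn]
          simp only [nsmul_eq_mul]
          field_simp
  have h2 := (measureReal_mono (μ := P) hcover).trans (measureReal_union_le _ _)
  rw [probReal_univ] at h2
  linarith

end

/-! ### Regret on the confidence event -/

section
variable {α : Type} {k : α → α → ℝ} {σ β : ℝ} {tie : List α → Finset α → α} {N : ℕ → ℕ} {f : α → ℝ}

theorem cumRegret_append (q S : List α) :
    cumRegret f (q ++ S) = cumRegret f q + cumRegret f S := by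
  simp [cumRegret]

theorem cumRegret_le_length_mul {S : List α} {c : ℝ} (h : ∀ x ∈ S, (⨆ x', f x') - f x ≤ c) :
    cumRegret f S ≤ S.length * c := by
  have := List.sum_le_card_nsmul (S.map fun x => (⨆ x', f x') - f x) c (by simpa using h)
  simpa [cumRegret] using this

theorem RKHSNormLE.abs_le {Ψ : ℝ} (hf : RKHSNormLE k f Ψ) {x : α} (hx : k x x = 1) :
    |f x| ≤ Ψ := by
  simpa [powerFun, hx] using hf.abs_sub_sum_le (Fin.elim0 : Fin 0 → α) Fin.elim0 x

/-- All confidence intervals of batch `i + 1` hold. -/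
def Confident [Fintype α] (k : α → α → ℝ) (σ β : ℝ) (tie : List α → Finset α → α) (N : ℕ → ℕ)
    (f : α → ℝ) (z : ℕ → ℝ) (i : ℕ) : Prop :=
  ∀ x, |f x - postMean k σ (batchPoints k σ β tie N f z i).get
    (batchAnswers k σ β tie N f z i) x| ≤ √β * postStd k σ (batchPoints k σ β tie N f z i).get x

theorem postStd_bpeBatch_le [Finite α] (hk : IsPSDKernel k) (hσ : 0 < σ) (hdiag : ∀ x, k x x = 1)
    (htie : IsTieBreak tie) (q : List α) {A : Finset α} {x : α} (hx : x ∈ A) {n : ℕ} (hn : 0 < n) :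
    postStd k σ (bpeBatch k σ tie q A n).get x ≤
      √(2 * maxInfoGain k σ n / (n * Real.log (1 + 1 / σ ^ 2))) := by
  have hlog : 0 < Real.log (1 + 1 / σ ^ 2) :=
    Real.log_pos (lt_add_of_pos_right _ (by positivity))
  have h1 := hk.mul_postVar_bpeBatch_le hσ hdiag htie q hx n
  have h2 : infoGain k σ (bpeBatch k σ tie q A n).get ≤ maxInfoGain k σ n :=
    (hk.infoGain_le hσ (bpeBatch k σ tie q A n).get).trans_eq
      (congrArg _ (length_bpeBatch tie q A n))
  refine Real.sqrt_le_sqrt ?_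
  have hn' : (0 : ℝ) < n := by exact_mod_cast hn
  rw [le_div_iff₀ (by positivity)]
  linarith

variable [Fintype α]

theorem mem_bpeState_succ {z : ℕ → ℝ} {i : ℕ} {x : α} :
    x ∈ (bpeState k σ β tie N f z (i + 1)).1 ↔ x ∈ (bpeState k σ β tie N f z i).1 ∧
      ∀ x' ∈ (bpeState k σ β tie N f z i).1,
        lcb k σ β (batchPoints k σ β tie N f z i) (batchAnswers k σ β tie N f z i) x' ≤
          ucb k σ β (batchPoints k σ β tie N f z i) (batchAnswers k σ β tie N f z i) x :=
  Finset.mem_filter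

/-- A maximizer of `f` is never eliminated. -/
theorem maximizer_mem_bpeState {z : ℕ → ℝ} {xm : α} (hxm : ∀ x, f x ≤ f xm) (b : ℕ)
    (hc : ∀ i < b, Confident k σ β tie N f z i) : xm ∈ (bpeState k σ β tie N f z b).1 := by
  induction b with
  | zero => exact Finset.mem_univ _
  | succ b ih =>
    refine mem_bpeState_succ.2 ⟨ih fun i hi => hc i (by omega), fun x' _ => ?_⟩
    have h1 := abs_le.1 (hc b (by omega) xm)
    have h2 := abs_le.1 (hc b (by omega) x')
    have := hxm x'
    unfold lcb ucb
    linarith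

/-- A point that survives batch `i + 1` has a gap of at most four confidence widths. -/
theorem gap_le_of_mem_bpeState (hk : IsPSDKernel k) (hσ : 0 < σ) (hdiag : ∀ x, k x x = 1)
    (htie : IsTieBreak tie) {z : ℕ → ℝ} {xm : α} (hxm : ∀ x, f x ≤ f xm) {i : ℕ}
    (hc : ∀ j < i + 1, Confident k σ β tie N f z j) (hN : 0 < N (i + 1)) {x : α}
    (hx : x ∈ (bpeState k σ β tie N f z (i + 1)).1) :
    f xm - f x ≤ 4 * √β * √(2 * maxInfoGain k σ (N (i + 1)) /
      (N (i + 1) * Real.log (1 + 1 / σ ^ 2))) := by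
  have hmem := maximizer_mem_bpeState hxm i fun j hj => hc j (by omega)
  have hx' := mem_bpeState_succ.1 hx
  have h1 := hx'.2 xm hmem
  have h2 := abs_le.1 (hc i (by omega) xm)
  have h3 := abs_le.1 (hc i (by omega) x)
  have h4 := postStd_bpeBatch_le hk hσ hdiag htie (bpeState k σ β tie N f z i).2 hmem hN
  have h5 := postStd_bpeBatch_le hk hσ hdiag htie (bpeState k σ β tie N f z i).2 hx'.1 hN
  have h6 := mul_le_mul_of_nonneg_left h4 (Real.sqrt_nonneg β)
  have h7 := mul_le_mul_of_nonneg_left h5 (Real.sqrt_nonneg β)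
  change √β * postStd k σ (batchPoints k σ β tie N f z i).get xm ≤ _ at h6
  change √β * postStd k σ (batchPoints k σ β tie N f z i).get x ≤ _ at h7
  unfold lcb ucb at h1
  linarith

/-- The regret of the first `b + 1` batches: the first batch costs at most `2Ψ` per query, each
later one at most four confidence widths of the batch before it. -/
theorem cumRegret_bpeState_le {Ψ : ℝ} (hf : RKHSNormLE k f Ψ) (hσ : 0 < σ)
    (hdiag : ∀ x, k x x = 1) (htie : IsTieBreak tie) [Nonempty α] {z : ℕ → ℝ} (b : ℕ)
    (hc : ∀ i < b, Confident k σ β tie N f z i) (hN : ∀ i < b, 0 < N (i + 1)) :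
    cumRegret f (bpeState k σ β tie N f z (b + 1)).2 ≤ N 1 * (2 * Ψ) +
      ∑ i ∈ Finset.range b, N (i + 2) * (4 * √β * √(2 * maxInfoGain k σ (N (i + 1)) /
        (N (i + 1) * Real.log (1 + 1 / σ ^ 2)))) := by
  obtain ⟨xm, hxm⟩ := Finite.exists_max f
  have hsup : ⨆ x', f x' = f xm :=
    le_antisymm (ciSup_le hxm) (le_ciSup (Finite.bddAbove_range f) xm)
  induction b with
  | zero =>
    rw [bpeState_succ]
    change cumRegret f ([] ++ bpeBatch k σ tie [] Finset.univ (N 1)) ≤ _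
    rw [List.nil_append, Finset.sum_range_zero, add_zero]
    refine (cumRegret_le_length_mul (c := 2 * Ψ) fun x _ => ?_).trans_eq ?_
    · have h1 := abs_le.1 (hf.abs_le (hdiag xm))
      have h2 := abs_le.1 (hf.abs_le (hdiag x))
      rw [hsup]
      linarith
    · rw [length_bpeBatch]
  | succ b ih =>
    have hne : (bpeState k σ β tie N f z (b + 1)).1.Nonempty :=
      ⟨xm, maximizer_mem_bpeState hxm (b + 1) hc⟩
    rw [bpeState_succ]
    change cumRegret f (_ ++ bpeBatch k σ tie _ _ (N (b + 2))) ≤ _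
    rw [cumRegret_append, Finset.sum_range_succ, ← add_assoc]
    refine add_le_add (ih (fun i hi => hc i (by omega)) fun i hi => hN i (by omega)) ?_
    refine (cumRegret_le_length_mul (c := 4 * √β * √(2 * maxInfoGain k σ (N (b + 1)) /
        (N (b + 1) * Real.log (1 + 1 / σ ^ 2)))) fun x hx => ?_).trans_eq ?_
    · rw [hsup]
      exact gap_le_of_mem_bpeState hf.isPSDKernel hσ hdiag htie hxm hc (hN b (by omega))
        (bpeBatch_subset htie _ hne _ x hx)
    · rw [length_bpeBatch]

end

/-! ### The batch schedule -/

section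
variable {a : ℝ} {T : ℕ}

theorem batchTotal_succ (n : ℕ) :
    batchTotal a T (n + 1) = batchTotal a T n + batchSize a T (n + 1) := rfl

theorem batchTotal_le (n : ℕ) : batchTotal a T n ≤ T := by
  induction n with
  | zero => exact Nat.zero_le _
  | succ n ih =>
    rw [batchTotal]
    omega

theorem batchTotal_mono : Monotone (batchTotal a T) :=
  monotone_nat_of_le_succ fun n => by rw [batchTotal_succ]; omega

/-- Only the last batch is truncated by the horizon. -/
theorem batchSize_eq_ceil {i : ℕ} (h : batchTotal a T (i + 1) < T) :
    batchSize a T (i + 1) = ⌈(T : ℝ) ^ (1 - a ^ (i + 1))⌉₊ := by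
  rw [batchTotal_succ] at h
  have h2 := batchTotal_le (a := a) (T := T) i
  rw [batchSize, Nat.add_sub_cancel] at h ⊢
  omega

theorem le_batchSize {i : ℕ} (h : batchTotal a T (i + 1) < T) :
    (T : ℝ) ^ (1 - a ^ (i + 1)) ≤ batchSize a T (i + 1) := by
  rw [batchSize_eq_ceil h]
  exact Nat.le_ceil _

theorem batchSize_le (ha0 : 0 < a) (ha1 : a < 1) (hT : 1 ≤ T) (i : ℕ) :
    (batchSize a T i : ℝ) ≤ 2 * (T : ℝ) ^ (1 - a ^ i) := by
  have hT' : (1 : ℝ) ≤ T := by exact_mod_cast hT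
  have h1 : (1 : ℝ) ≤ (T : ℝ) ^ (1 - a ^ i) :=
    Real.one_le_rpow hT' (sub_nonneg.2 (pow_le_one₀ ha0.le ha1.le))
  have h2 : (batchSize a T i : ℝ) ≤ ⌈(T : ℝ) ^ (1 - a ^ i)⌉₊ := by
    exact_mod_cast min_le_left _ _
  have h3 := (Nat.ceil_lt_add_one (zero_le_one.trans h1)).le
  linarith

theorem rpow_one_sub_pow (hT : 1 ≤ T) (i : ℕ) :
    (T : ℝ) ^ (1 - a ^ i) = T * Real.exp (-(a ^ i * Real.log T)) := by
  have hT' : (0 : ℝ) < T := by exact_mod_cast hT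
  rw [Real.rpow_def_of_pos hT', mul_sub, mul_one, sub_eq_add_neg, Real.exp_add, Real.exp_log hT',
    mul_comm (Real.log _)]

/-- Once `a ^ m log T ≤ 1`, every full batch has size at least `T / e`, so three of them exhaust
the horizon. -/
theorem batchTotal_add_three (ha0 : 0 < a) (ha1 : a < 1) (hT : 1 ≤ T) {m : ℕ}
    (hm : a ^ m * Real.log T ≤ 1) : batchTotal a T (m + 3) = T := by
  by_contra hne
  have hlt : batchTotal a T (m + 3) < T := lt_of_le_of_ne (batchTotal_le _) hne
  have hT' : (0 : ℝ) < T := by exact_mod_cast hT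
  have hlog : 0 ≤ Real.log T := Real.log_natCast_nonneg T
  have hsize : ∀ i, m ≤ i → i + 1 ≤ m + 3 → (T : ℝ) * Real.exp (-1) ≤ batchSize a T (i + 1) := by
    intro i h1 h2
    refine le_trans ?_ (le_batchSize ((batchTotal_mono h2).trans_lt hlt))
    rw [rpow_one_sub_pow hT]
    have : a ^ (i + 1) ≤ a ^ m := pow_le_pow_of_le_one ha0.le ha1.le (by omega)
    have := mul_le_mul_of_nonneg_right this hlog
    gcongr
    linarith
  have h0 := hsize m le_rfl (by omega)
  have h1 := hsize (m + 1) (by omega) (by omega)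
  have h2 := hsize (m + 2) (by omega) le_rfl
  have hsum : batchSize a T (m + 1) + batchSize a T (m + 2) + batchSize a T (m + 3) < T := by
    have e : batchTotal a T (m + 3) = batchTotal a T m + batchSize a T (m + 1) +
      batchSize a T (m + 2) + batchSize a T (m + 3) := rfl
    omega
  have hsum' : (batchSize a T (m + 1) : ℝ) + batchSize a T (m + 2) + batchSize a T (m + 3) < T := by
    exact_mod_cast hsum
  have he : 1 < 3 * Real.exp (-1) := by
    rw [Real.exp_neg, ← div_eq_mul_inv, lt_div_iff₀ (Real.exp_pos _)]
    linarith [Real.exp_one_lt_three]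
  nlinarith

theorem batchTotal_numBatches (h : ∃ n, batchTotal a T n = T) :
    batchTotal a T (numBatches a T) = T :=
  Nat.sInf_mem h

theorem batchTotal_lt_of_lt_numBatches {n : ℕ} (h : n < numBatches a T) : batchTotal a T n < T :=
  lt_of_le_of_ne (batchTotal_le n)
    (Nat.notMem_of_lt_sInf (s := {n | batchTotal a T n = T}) h)

/-- The index `m` at which `a ^ m log T` first drops to `1`: it controls the number of batches. -/
theorem exists_numBatches_le (ha0 : 0 < a) (ha1 : a < 1) (hT : 1 ≤ T) (hlogT : 1 < Real.log T) :
    ∃ m : ℕ, numBatches a T ≤ m + 3 ∧ 0 < numBatches a T ∧ a ≤ a ^ m * Real.log T ∧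
      m * -Real.log a ≤ Real.log (Real.log T) - Real.log a := by
  have hex : ∃ m : ℕ, a ^ m * Real.log T ≤ 1 := by
    obtain ⟨m, hm⟩ := exists_pow_lt_of_lt_one (show (0 : ℝ) < (Real.log T)⁻¹ by positivity) ha1
    refine ⟨m, ?_⟩
    rw [← le_div_iff₀ (by linarith), one_div]
    exact hm.le
  classical
  obtain ⟨m, hm, hmin⟩ : ∃ m : ℕ, a ^ m * Real.log T ≤ 1 ∧ ∀ n < m, ¬ a ^ n * Real.log T ≤ 1 :=
    ⟨Nat.find hex, Nat.find_spec hex, fun n => Nat.find_min hex⟩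
  have htot := batchTotal_add_three ha0 ha1 hT hm
  obtain _ | m := m
  · rw [pow_zero, one_mul] at hm
    linarith
  have hm' := not_le.1 (hmin m (Nat.lt_succ_self m))
  refine ⟨m + 1, Nat.sInf_le htot, ?_, ?_, ?_⟩
  · refine Nat.pos_of_ne_zero fun h => ?_
    have := batchTotal_numBatches ⟨_, htot⟩
    rw [h, batchTotal] at this
    omega
  · rw [pow_succ']
    nlinarith
  · have h := Real.log_pos hm'
    rw [Real.log_mul (pow_pos ha0 m).ne' (by linarith), Real.log_pow] at h
    push_cast
    linarith

/-- The relative errors `T ^ (-c a ^ j)` of the batches decay geometrically backwards from the last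
batch, so they have a sum bounded independently of `T`. -/
theorem sum_exp_neg_le {c L : ℝ} (hc : 0 < c) (ha0 : 0 < a) (ha1 : a < 1) {m b : ℕ}
    (hb : b ≤ m + 2) (hm : a ≤ a ^ m * L) :
    ∑ i ∈ Finset.range b, Real.exp (-(c * (a ^ (i + 1) * L))) ≤ 1 / (c * a ^ 3 * (1 - a)) := by
  have hL : 0 < L := by
    by_contra h
    have := mul_nonpos_of_nonneg_of_nonpos (pow_nonneg ha0.le m) (not_lt.1 h)
    linarith
  have hterm : ∀ i ∈ Finset.range (m + 2),
      Real.exp (-(c * (a ^ (i + 1) * L))) ≤ a ^ (m + 2 - 1 - i) * (1 / (c * a ^ 3)) := by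
    intro i hi
    rw [Finset.mem_range] at hi
    set x := c * (a ^ (i + 1) * L) with hx
    have hx0 : 0 < x := by positivity
    have h1 : Real.exp (-x) ≤ 1 / x := by
      rw [Real.exp_neg, one_div]
      exact inv_anti₀ hx0 (by linarith [Real.add_one_le_exp x])
    refine h1.trans ?_
    rw [mul_one_div, div_le_div_iff₀ hx0 (by positivity), one_mul, hx]
    have h2 : a ^ (m + 2 - 1 - i) * (c * (a ^ (i + 1) * L)) = c * (a ^ 2 * (a ^ m * L)) := by
      have : a ^ (m + 2 - 1 - i) * a ^ (i + 1) = a ^ m * a ^ 2 := by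
        rw [← pow_add, ← pow_add]; congr 1; omega
      linear_combination c * L * this
    rw [h2]
    have : a ^ 3 ≤ a ^ 2 * (a ^ m * L) := by
      rw [pow_succ]; gcongr
    gcongr
  calc _ ≤ ∑ i ∈ Finset.range (m + 2), Real.exp (-(c * (a ^ (i + 1) * L))) :=
        Finset.sum_le_sum_of_subset_of_nonneg (Finset.range_subset_range.2 hb)
          fun i _ _ => (Real.exp_pos _).le
    _ ≤ ∑ i ∈ Finset.range (m + 2), a ^ (m + 2 - 1 - i) * (1 / (c * a ^ 3)) :=
        Finset.sum_le_sum hterm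
    _ = (∑ i ∈ Finset.range (m + 2), a ^ i) * (1 / (c * a ^ 3)) := by
        rw [← Finset.sum_mul, Finset.sum_range_reflect fun i => a ^ i]
    _ ≤ (1 - a)⁻¹ * (1 / (c * a ^ 3)) := by
        gcongr
        have := (summable_geometric_of_lt_one ha0.le ha1).sum_le_tsum (Finset.range (m + 2))
          fun i _ => by positivity
        rwa [tsum_geometric_of_lt_one ha0.le ha1] at this
    _ = _ := by
        have : 1 - a ≠ 0 := by linarith
        field_simp

end

/-! ### The regret bound for a general kernel -/

theorem log_nat_conditions {T : ℕ} (hT : ⌈Real.exp (Real.exp (Real.exp 1))⌉₊ ≤ T) :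
    1 ≤ T ∧ 1 < Real.log T ∧ 1 ≤ Real.log (Real.log T) ∧
      1 ≤ Real.log (Real.log (Real.log T)) := by
  have h0 : Real.exp (Real.exp (Real.exp 1)) ≤ T := Nat.ceil_le.1 hT
  have hT0 : (0 : ℝ) < T := (Real.exp_pos _).trans_le h0
  have h1 : Real.exp (Real.exp 1) ≤ Real.log T := (Real.le_log_iff_exp_le hT0).2 h0
  have hL0 : 0 < Real.log T := (Real.exp_pos _).trans_le h1
  have h2 : Real.exp 1 ≤ Real.log (Real.log T) := (Real.le_log_iff_exp_le hL0).2 h1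
  have h3 : 1 ≤ Real.log (Real.log (Real.log T)) :=
    (Real.le_log_iff_exp_le ((Real.exp_pos _).trans_le h2)).2 h2
  have he : ∀ x : ℝ, 0 < x → 1 < Real.exp x := fun x hx => by
    have := Real.add_one_lt_exp hx.ne'
    linarith
  exact ⟨by exact_mod_cast hT0, (he _ (Real.exp_pos _)).trans_le h1,
    (he 1 one_pos).le.trans h2, h3⟩

/-- A bound, depending only on `a`, for the ratio of `√β` to `Λ + √(log log log T)`. -/
def widthConst (a : ℝ) : ℝ :=
  √(2 * (1 + Real.log (4 + 1 / -Real.log a)))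

/-- Since `B` is of order `log log T`, its logarithm is of order `log log log T`. -/
theorem log_numBatches_le {a : ℝ} {T B m : ℕ} (ha0 : 0 < a) (ha1 : a < 1)
    (hB0 : 0 < B) (hB : B ≤ m + 3) (hm : m * -Real.log a ≤ Real.log (Real.log T) - Real.log a)
    (hL : 1 ≤ Real.log (Real.log T)) (hL' : 1 ≤ Real.log (Real.log (Real.log T))) :
    Real.log B ≤
      (1 + Real.log (4 + 1 / -Real.log a)) * Real.log (Real.log (Real.log T)) := by
  have hla : 0 < -Real.log a := by linarith [Real.log_neg ha0 ha1]
  set D := 4 + 1 / -Real.log a with hD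
  have hD1 : 1 ≤ D := by
    have : 0 < 1 / -Real.log a := by positivity
    linarith
  have hm' : (m : ℝ) ≤ Real.log (Real.log T) / -Real.log a + 1 := by
    rw [div_add_one hla.ne', le_div_iff₀ hla]
    linarith
  have hBle : (B : ℝ) ≤ D * Real.log (Real.log T) := by
    have h1 : (B : ℝ) ≤ m + 3 := by exact_mod_cast hB
    have h2 : D * Real.log (Real.log T) =
        Real.log (Real.log T) / -Real.log a + 4 * Real.log (Real.log T) := by
      rw [hD]; ring
    linarith
  have hlD := Real.log_nonneg hD1
  calc Real.log B ≤ Real.log (D * Real.log (Real.log T)) :=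
        Real.log_le_log (by exact_mod_cast hB0) hBle
    _ = Real.log D + Real.log (Real.log (Real.log T)) :=
        Real.log_mul (by linarith) (by linarith)
    _ ≤ _ := by nlinarith

theorem sqrt_bpeBeta_le {Ψ δ c l : ℝ} {n B : ℕ} (hΨ : 0 ≤ Ψ) (hδ : 0 < δ) (hδ1 : δ < 1)
    (hn : 0 < n) (hB : 0 < B) (hc : 1 ≤ c) (hl : 0 ≤ l) (hBl : Real.log B ≤ c * l) :
    √(bpeBeta Ψ δ n B) ≤ √(2 * c) * ((Ψ + √(Real.log (n / δ))) + √l) := by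
  rw [sqrt_bpeBeta hΨ]
  have hn' : (1 : ℝ) ≤ n := by exact_mod_cast hn
  have hB' : (0 : ℝ) < B := by exact_mod_cast hB
  have hlog : 0 ≤ Real.log (n / δ) := Real.log_nonneg (by rw [le_div_iff₀ hδ]; linarith)
  have h1 : Real.log (n * B / δ) = Real.log (n / δ) + Real.log B := by
    rw [← Real.log_mul (by positivity) hB'.ne']
    congr 1
    ring
  have hs1 : 1 ≤ √(2 * c) := by
    rw [Real.one_le_sqrt]; linarith
  have h2 : √(2 * Real.log (n * B / δ)) ≤ √(2 * c) * (√(Real.log (n / δ)) + √l) := by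
    have h3 : √(Real.log (n / δ) + l) ≤ √(Real.log (n / δ)) + √l := by
      rw [Real.sqrt_le_left (by positivity)]
      nlinarith [Real.sq_sqrt hlog, Real.sq_sqrt hl, Real.sqrt_nonneg (Real.log (n / δ)),
        Real.sqrt_nonneg l, mul_nonneg (Real.sqrt_nonneg (Real.log (n / δ))) (Real.sqrt_nonneg l)]
    refine le_trans ?_ (mul_le_mul_of_nonneg_left h3 (Real.sqrt_nonneg _))
    rw [← Real.sqrt_mul (by linarith)]
    refine Real.sqrt_le_sqrt ?_
    rw [h1]
    nlinarith
  nlinarith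

/-- The contribution of one batch: with `N₁ ≥ T ^ (1 - p)` points in the previous batch and
`N₂ ≤ 2 T ^ (1 - a p)` in the current one, the bound `γ ≤ g (N₁ / T) ^ θ` gives a regret of
order `√(T g)` times `T ^ (-(a - (1 - θ) / 2) p)`. -/
theorem batch_term_le {T N₁ N₂ g γ θ a p L : ℝ} (hT : 1 ≤ T) (hL : 0 < L) (hg : 0 ≤ g)
    (hθ1 : θ ≤ 1) (hN₁ : T * Real.exp (-(p * Real.log T)) ≤ N₁)
    (hN₂ : N₂ ≤ 2 * (T * Real.exp (-(a * p * Real.log T))))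
    (hγ : γ ≤ g * (N₁ / T) ^ θ) :
    N₂ * √(2 * γ / (N₁ * L)) ≤
      2 * √(2 / L) * √(T * g) * Real.exp (-((a - (1 - θ) / 2) * (p * Real.log T))) := by
  have hT0 : 0 < T := by linarith
  have hN0 : 0 < N₁ := lt_of_lt_of_le (by positivity) hN₁
  set r := N₁ / T with hr
  have hr0 : 0 < r := by positivity
  have hrle : Real.exp (-(p * Real.log T)) ≤ r := by
    rw [hr, le_div_iff₀ hT0, mul_comm]; exact hN₁
  have hpow : r ^ θ / r ≤ Real.exp ((1 - θ) * (p * Real.log T)) := by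
    rw [← Real.rpow_sub_one hr0.ne']
    calc r ^ (θ - 1) ≤ (Real.exp (-(p * Real.log T))) ^ (θ - 1) :=
          Real.rpow_le_rpow_of_nonpos (Real.exp_pos _) hrle (by linarith)
      _ = _ := by rw [← Real.exp_mul]; ring_nf
  have hsq : √(2 * γ / (N₁ * L)) ≤
      √(2 / L) * √(g / T) * Real.exp ((1 - θ) / 2 * (p * Real.log T)) := by
    have hexp : Real.exp ((1 - θ) / 2 * (p * Real.log T)) =
        √(Real.exp ((1 - θ) * (p * Real.log T))) := by
      rw [← Real.exp_half]; ring_nf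
    rw [hexp, ← Real.sqrt_mul (by positivity), ← Real.sqrt_mul (by positivity)]
    refine Real.sqrt_le_sqrt ?_
    have hN : N₁ = T * r := by rw [hr]; field_simp
    calc 2 * γ / (N₁ * L) ≤ 2 * (g * r ^ θ) / (N₁ * L) := by gcongr
      _ = 2 / L * (g / T) * (r ^ θ / r) := by rw [hN]; field_simp
      _ ≤ _ := by gcongr
  have hTg : T * √(g / T) = √(T * g) := by
    rw [← Real.sqrt_sq hT0.le, ← Real.sqrt_mul (sq_nonneg T), Real.sqrt_sq hT0.le]
    congr 1
    field_simp
  calc N₂ * √(2 * γ / (N₁ * L)) ≤ 2 * (T * Real.exp (-(a * p * Real.log T))) *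
        (√(2 / L) * √(g / T) * Real.exp ((1 - θ) / 2 * (p * Real.log T))) := by gcongr
    _ = 2 * √(2 / L) * (T * √(g / T)) *
        (Real.exp (-(a * p * Real.log T)) * Real.exp ((1 - θ) / 2 * (p * Real.log T))) := by ring
    _ = _ := by
        rw [hTg, ← Real.exp_add]
        congr 2
        ring

/-- The constant of the regret bound: the first summand accounts for the first batch, the second
for all others. -/
def regretConst (a σ θ g₀ : ℝ) : ℝ :=
  4 / √g₀ + 8 * √(2 / Real.log (1 + 1 / σ ^ 2)) *
    (1 / ((a - (1 - θ) / 2) * a ^ 3 * (1 - a))) * widthConst a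

/-- BPE on a kernel with unit diagonal, under a growth condition on the information gain. Both parts
of the theorem are instances: `θ = 0` with `g = γ_T`, and `θ = d / (2ν + d)` with `g = γbar_T`. -/
theorem bpe_regret_bound {α : Type} [Fintype α] [Nonempty α] {k : α → α → ℝ} {a σ θ g₀ g : ℝ}
    {T : ℕ} (ha0 : 0 < a) (ha1 : a < 1) (hθ1 : θ ≤ 1) (haθ : (1 - θ) / 2 < a)
    (hσ : 0 < σ) (hg₀ : 0 < g₀) (hT : ⌈Real.exp (Real.exp (Real.exp 1))⌉₊ ≤ T)
    (hdiag : ∀ x, k x x = 1) (hg : g₀ * (T : ℝ) ^ θ ≤ g)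
    (hγ : ∀ N : ℕ, N ≤ T → (T : ℝ) ^ (1 - a) ≤ N → maxInfoGain k σ N ≤ g * (N / T) ^ θ)
    {Ψ : ℝ} (hΨ : 0 < Ψ) {f : α → ℝ} (hf : RKHSNormLE k f Ψ) {tie : List α → Finset α → α}
    (htie : IsTieBreak tie) {δ : ℝ} (hδ : 0 < δ) (hδ1 : δ < 1)
    {Ω : Type u} [MeasurableSpace Ω] {P : Measure Ω} [IsProbabilityMeasure P] {z : ℕ → Ω → ℝ}
    (hz : ∀ t, Measurable (z t)) (hind : iIndepFun z P)
    (hlaw : ∀ t, P.map (z t) = gaussianReal 0 (σ ^ 2).toNNReal) :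
    1 - δ ≤ P.real {ω | cumRegret f (bpeQueries k σ a Ψ δ T tie f (fun t => z t ω)) ≤
      regretConst a σ θ g₀ * ((Ψ + √(Real.log (Fintype.card α / δ))) +
        √(Real.log (Real.log (Real.log T)))) * √(T * g)} := by
  obtain ⟨hT1, hlogT, hL2, hL3⟩ := log_nat_conditions hT
  obtain ⟨m, hBm, hB0, hma, hmlog⟩ := exists_numBatches_le ha0 ha1 hT1 hlogT
  refine one_sub_le_measureReal_confidence (N := batchSize a T) (tie := tie) hf hΨ.le hσ hδ hδ1
    hz hind hlaw hB0 fun ω hω => ?_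
  have hT1' : (1 : ℝ) ≤ T := by exact_mod_cast hT1
  have hT0 : (0 : ℝ) < T := by linarith
  have hg0 : 0 < g := lt_of_lt_of_le (by positivity) hg
  have hlσ : 0 < Real.log (1 + 1 / σ ^ 2) := Real.log_pos (lt_add_of_pos_right _ (by positivity))
  set c := a - (1 - θ) / 2 with hc
  have hc0 : 0 < c := by linarith
  set Λ := (Ψ + √(Real.log (Fintype.card α / δ))) + √(Real.log (Real.log (Real.log T))) with hΛ
  have hΨΛ : Ψ ≤ Λ := by
    have := Real.sqrt_nonneg (Real.log (Fintype.card α / δ))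
    have := Real.sqrt_nonneg (Real.log (Real.log (Real.log T)))
    linarith
  have hlD : 0 ≤ Real.log (4 + 1 / -Real.log a) := Real.log_nonneg (by
    have : 0 < 1 / -Real.log a := by
      have := Real.log_neg ha0 ha1
      exact one_div_pos.2 (by linarith)
    linarith)
  have hΛ0 : 0 ≤ Λ := hΨ.le.trans hΨΛ
  have hw0 : 0 ≤ widthConst a := Real.sqrt_nonneg _
  set β := bpeBeta Ψ δ (Fintype.card α) (numBatches a T) with hβ
  have hwidth : √β ≤ widthConst a * Λ :=
    sqrt_bpeBeta_le hΨ.le hδ hδ1 Fintype.card_pos hB0 (by linarith) (by linarith)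
      (log_numBatches_le ha0 ha1 hB0 hBm hmlog hL2 hL3)
  obtain ⟨b, hb⟩ : ∃ b, numBatches a T = b + 1 := ⟨numBatches a T - 1, by omega⟩
  have hconf : ∀ i < b, Confident k σ β tie (batchSize a T) f (fun t => z t ω) i :=
    fun i hi x => not_lt.1 (hω i (by omega) x)
  have hlt : ∀ i < b, batchTotal a T (i + 1) < T := fun i hi =>
    batchTotal_lt_of_lt_numBatches (by omega)
  have hNge : ∀ i < b, (T : ℝ) ^ (1 - a ^ (i + 1)) ≤ batchSize a T (i + 1) := fun i hi =>
    le_batchSize (hlt i hi)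
  have hNpos : ∀ i < b, 0 < batchSize a T (i + 1) := fun i hi => by
    have h := (Real.rpow_pos_of_pos hT0 _).trans_le (hNge i hi)
    exact_mod_cast h
  have hreg := cumRegret_bpeState_le (k := k) (β := β) hf hσ hdiag htie b hconf hNpos
  rw [Set.mem_ofPred_eq, bpeQueries, ← hβ, hb]
  refine hreg.trans ?_
  -- the first batch, played without information, is short
  have hfirst : (batchSize a T 1 : ℝ) * (2 * Ψ) ≤ 4 / √g₀ * Λ * √(T * g) := by
    have h1 := batchSize_le ha0 ha1 hT1 1
    rw [pow_one] at h1
    have h2 : √g₀ * (T : ℝ) ^ (1 - a) ≤ √(T * g) := by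
      have h3 : (T : ℝ) ^ (1 - a) ≤ √((T : ℝ) ^ (1 + θ)) := by
        rw [Real.sqrt_eq_rpow, ← Real.rpow_mul hT0.le]
        exact Real.rpow_le_rpow_of_exponent_le hT1' (by linarith)
      refine (mul_le_mul_of_nonneg_left h3 (Real.sqrt_nonneg _)).trans ?_
      rw [← Real.sqrt_mul hg₀.le]
      refine Real.sqrt_le_sqrt ?_
      rw [Real.rpow_add hT0, Real.rpow_one]
      nlinarith
    have hs : 0 < √g₀ := Real.sqrt_pos.2 hg₀
    have h4 : (T : ℝ) ^ (1 - a) ≤ √(T * g) / √g₀ := by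
      rw [le_div_iff₀ hs, mul_comm]; exact h2
    calc (batchSize a T 1 : ℝ) * (2 * Ψ) ≤ (2 * (√(T * g) / √g₀)) * (2 * Λ) := by
          gcongr
          linarith
      _ = _ := by ring
  have hrest : ∑ i ∈ Finset.range b, (batchSize a T (i + 2) : ℝ) *
      (4 * √β * √(2 * maxInfoGain k σ (batchSize a T (i + 1)) /
        (batchSize a T (i + 1) * Real.log (1 + 1 / σ ^ 2)))) ≤
      8 * √(2 / Real.log (1 + 1 / σ ^ 2)) * (1 / (c * a ^ 3 * (1 - a))) * widthConst a * Λ *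
        √(T * g) := by
    have hterm : ∀ i ∈ Finset.range b, (batchSize a T (i + 2) : ℝ) *
        (4 * √β * √(2 * maxInfoGain k σ (batchSize a T (i + 1)) /
          (batchSize a T (i + 1) * Real.log (1 + 1 / σ ^ 2)))) ≤
        8 * √β * √(2 / Real.log (1 + 1 / σ ^ 2)) * √(T * g) *
          Real.exp (-(c * (a ^ (i + 1) * Real.log T))) := by
      intro i hi
      have hi' := Finset.mem_range.1 hi
      have h1 := hNge i hi'
      have h2 := batchSize_le ha0 ha1 hT1 (i + 2)
      have h3 := hγ (batchSize a T (i + 1))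
        (by
          have := batchTotal_succ (a := a) (T := T) i
          have := hlt i hi'
          omega)
        (le_trans (Real.rpow_le_rpow_of_exponent_le hT1' (by
          have : a ^ (i + 1) ≤ a := pow_le_of_le_one ha0.le ha1.le (by omega)
          linarith)) h1)
      rw [rpow_one_sub_pow hT1] at h1 h2
      rw [show a ^ (i + 2) = a * a ^ (i + 1) by ring] at h2
      have h4 := mul_le_mul_of_nonneg_left
        (batch_term_le hT1' hlσ hg0.le hθ1 h1 h2 h3) (mul_nonneg zero_le_four (Real.sqrt_nonneg β))
      refine le_trans (le_of_eq ?_) (h4.trans (le_of_eq ?_)) <;> ring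
    have hK := sum_exp_neg_le (b := b) hc0 ha0 ha1 (by omega) hma
    calc _ ≤ ∑ i ∈ Finset.range b, 8 * √β * √(2 / Real.log (1 + 1 / σ ^ 2)) * √(T * g) *
          Real.exp (-(c * (a ^ (i + 1) * Real.log T))) := Finset.sum_le_sum hterm
      _ = 8 * √β * √(2 / Real.log (1 + 1 / σ ^ 2)) * √(T * g) *
          ∑ i ∈ Finset.range b, Real.exp (-(c * (a ^ (i + 1) * Real.log T))) := by
        rw [Finset.mul_sum]
      _ ≤ 8 * (widthConst a * Λ) * √(2 / Real.log (1 + 1 / σ ^ 2)) * √(T * g) *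
          (1 / (c * a ^ 3 * (1 - a))) := by gcongr
      _ = _ := by ring
  calc _ ≤ 4 / √g₀ * Λ * √(T * g) + 8 * √(2 / Real.log (1 + 1 / σ ^ 2)) *
        (1 / (c * a ^ 3 * (1 - a))) * widthConst a * Λ * √(T * g) := add_le_add hfirst hrest
    _ = _ := by rw [regretConst, ← hc]; ring

/-! ### The squared exponential and Matérn kernels -/

theorem seKernel_self {d : ℕ} (l : ℝ) (x : EuclideanSpace ℝ (Fin d)) : seKernel l x x = 1 := by
  simp [seKernel]

theorem maternKernel_self {d : ℕ} (ν l : ℝ) (x : EuclideanSpace ℝ (Fin d)) :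
    maternKernel ν l x x = 1 := by
  simp [maternKernel]

/-- For `a > 1/2`, monotonicity of the information gain is the only growth condition needed. -/
theorem exists_regretBound_of_half_lt {d : ℕ}
    {κ : EuclideanSpace ℝ (Fin d) → EuclideanSpace ℝ (Fin d) → ℝ} (hκ : ∀ x, κ x x = 1) {σ a : ℝ}
    (hσ : 0 < σ) (ha : 1 / 2 < a) (ha1 : a < 1) :
    ∃ (C : ℝ) (T₀ : ℕ), ∀ T : ℕ, T₀ ≤ T →
      ∀ X : Finset (EuclideanSpace ℝ (Fin d)), X.Nonempty →
        (∀ x ∈ X, ∀ i, x i ∈ Set.Icc (0 : ℝ) 1) →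
        BPERegretBound.{u} κ σ a X T C
          (maxInfoGain (fun x y : X => κ (x : EuclideanSpace ℝ (Fin d)) y) σ T) := by
  refine ⟨regretConst a σ 0 (1 / 2 * Real.log (1 + 1 / σ ^ 2)),
    ⌈Real.exp (Real.exp (Real.exp 1))⌉₊, fun T hT X hX _ => ?_⟩
  intro Ψ hΨ f hf tie htie δ hδ hδ1 Ω _ P _ z hz hind hlaw
  have : Nonempty X := hX.to_subtype
  have hk := hf.isPSDKernel
  have hlσ : 0 < Real.log (1 + 1 / σ ^ 2) := Real.log_pos (lt_add_of_pos_right _ (by positivity))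
  have h := bpe_regret_bound (θ := 0) (g₀ := 1 / 2 * Real.log (1 + 1 / σ ^ 2))
    (g := maxInfoGain (fun x y : X => κ (x : EuclideanSpace ℝ (Fin d)) y) σ T)
    (k := fun x y : X => κ (x : EuclideanSpace ℝ (Fin d)) y)
    (by linarith) ha1 zero_le_one (by linarith) hσ (by positivity) hT (fun x => hκ x)
    (by
      rw [Real.rpow_zero, mul_one]
      exact (hk.le_maxInfoGain_one hσ fun x => hκ x).trans
        (hk.maxInfoGain_mono hσ (log_nat_conditions hT).1))
    (fun N hN _ => by
      rw [Real.rpow_zero, mul_one]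
      exact hk.maxInfoGain_mono hσ hN)
    hΨ hf htie hδ hδ1 hz hind hlaw
  rwa [Fintype.card_coe] at h

/-- For smaller `a`, polynomial decay of `γbar_t / t` makes up for the faster growth of the
batch sizes. -/
theorem exists_regretBound_of_growth {d : ℕ}
    {κ : EuclideanSpace ℝ (Fin d) → EuclideanSpace ℝ (Fin d) → ℝ} (hκ : ∀ x, κ x x = 1)
    {σ a θ c' : ℝ} (hσ : 0 < σ) (ha0 : 0 < a) (ha1 : a < 1) (hθ1 : θ ≤ 1)
    (ha : (1 - θ) / 2 < a) {α γbar : ℕ → ℝ} {t₀ : ℕ} (hc' : 0 < c')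
    (hα : MonotoneOn α (Set.Ici 1)) (hγbar : ∀ t : ℕ, 1 ≤ t → γbar t = c' * (t : ℝ) ^ θ * α t) :
    ∃ (C : ℝ) (T₀ : ℕ), ∀ T : ℕ, T₀ ≤ T →
      ∀ X : Finset (EuclideanSpace ℝ (Fin d)), X.Nonempty →
        (∀ x ∈ X, ∀ i, x i ∈ Set.Icc (0 : ℝ) 1) →
        (∀ t : ℕ, t₀ ≤ t → 1 ≤ t →
          maxInfoGain (fun x y : X => κ (x : EuclideanSpace ℝ (Fin d)) y) σ t ≤ γbar t) →
        BPERegretBound.{u} κ σ a X T C (γbar T) := by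
  set s := max t₀ 1 with hs
  have hs1 : 1 ≤ s := le_max_right _ _
  obtain ⟨T₁, hT₁⟩ : ∃ T₁ : ℕ, ∀ T : ℕ, T₁ ≤ T → (s : ℝ) ≤ (T : ℝ) ^ (1 - a) :=
    Filter.eventually_atTop.1 (((tendsto_rpow_atTop (by linarith : 0 < 1 - a)).comp
      tendsto_natCast_atTop_atTop).eventually_ge_atTop (s : ℝ))
  refine ⟨regretConst a σ θ (c' * α s), max ⌈Real.exp (Real.exp (Real.exp 1))⌉₊ T₁,
    fun T hT X hX _ hX' => ?_⟩
  intro Ψ hΨ f hf tie htie δ hδ hδ1 Ω _ P _ z hz hind hlaw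
  have : Nonempty X := hX.to_subtype
  have hk := hf.isPSDKernel
  have hlσ : 0 < Real.log (1 + 1 / σ ^ 2) := Real.log_pos (lt_add_of_pos_right _ (by positivity))
  have hT2 := (le_max_left _ _).trans hT
  have hT1 := (log_nat_conditions hT2).1
  have hsT := hT₁ T ((le_max_right _ _).trans hT)
  have hT1' : (1 : ℝ) ≤ T := by exact_mod_cast hT1
  have hT0 : (0 : ℝ) < T := by linarith
  -- `α s` is positive because the information gain is
  have hαs : 0 < α s := by
    have h1 := hX' s (le_max_left _ _) hs1
    have h2 := hk.le_maxInfoGain_one hσ fun x => hκ x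
    have h3 := hk.maxInfoGain_mono hσ hs1
    have h4 : 0 < γbar s := by linarith
    rw [hγbar s hs1] at h4
    have : (0 : ℝ) < s := by exact_mod_cast hs1
    exact pos_of_mul_pos_right h4 (by positivity)
  have hsT' : s ≤ T := by
    have h1 : (T : ℝ) ^ (1 - a) ≤ (T : ℝ) ^ (1 : ℝ) :=
      Real.rpow_le_rpow_of_exponent_le hT1' (by linarith)
    rw [Real.rpow_one] at h1
    exact_mod_cast hsT.trans h1
  have h := bpe_regret_bound (θ := θ) (g₀ := c' * α s) (g := γbar T)
    (k := fun x y : X => κ (x : EuclideanSpace ℝ (Fin d)) y)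
    ha0 ha1 hθ1 ha hσ (by positivity) hT2 (fun x => hκ x)
    (by
      have := hα hs1 hT1 hsT'
      rw [hγbar T hT1, mul_right_comm]
      gcongr)
    (fun N hN hN' => by
      have hsN : s ≤ N := by exact_mod_cast hsT.trans hN'
      have hN1 : 1 ≤ N := hs1.trans hsN
      have := hα hN1 hT1 hN
      refine (hX' N ((le_max_left _ _).trans hsN) hN1).trans ?_
      rw [hγbar N hN1, hγbar T hT1, Real.div_rpow (Nat.cast_nonneg N) hT0.le]
      calc c' * (N : ℝ) ^ θ * α N ≤ c' * (N : ℝ) ^ θ * α T := by gcongr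
        _ = _ := by
          have := (Real.rpow_pos_of_pos hT0 θ).ne'
          field_simp)
    hΨ hf htie hδ hδ1 hz hind hlaw
  rwa [Fintype.card_coe] at h

end BatchedKernelBandit

end

theorem theorem1 (d : ℕ) (hd : 0 < d) (l σ : ℝ) (hl : 0 < l) (hσ : 0 < σ) :
    -- the SE kernel, `a ∈ (1/2, 1)`
    (∀ a : ℝ, 1 / 2 < a → a < 1 →
      ∃ (C : ℝ) (T₀ : ℕ), ∀ T : ℕ, T₀ ≤ T →
      ∀ X : Finset (EuclideanSpace ℝ (Fin d)), X.Nonempty →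
        (∀ x ∈ X, ∀ i, x i ∈ Set.Icc (0 : ℝ) 1) →
        BPERegretBound.{u} (seKernel l) σ a X T C
          (maxInfoGain (fun x y : X => seKernel l (x : EuclideanSpace ℝ (Fin d)) y) σ T)) ∧
    -- the Matérn kernel, `a ∈ (1/2, 1)`
    (∀ ν : ℝ, 0 < ν → ∀ a : ℝ, 1 / 2 < a → a < 1 →
      ∃ (C : ℝ) (T₀ : ℕ), ∀ T : ℕ, T₀ ≤ T →
      ∀ X : Finset (EuclideanSpace ℝ (Fin d)), X.Nonempty →
        (∀ x ∈ X, ∀ i, x i ∈ Set.Icc (0 : ℝ) 1) →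
        BPERegretBound.{u} (maternKernel ν l) σ a X T C
          (maxInfoGain (fun x y : X => maternKernel ν l (x : EuclideanSpace ℝ (Fin d)) y) σ T)) ∧
    -- the Matérn kernel, `a ∈ (ν/(2ν+d), 1/2]`, with `γbar t = c' t^(d/(2ν+d)) α_t`
    (∀ ν : ℝ, 0 < ν → ∀ a : ℝ, ν / (2 * ν + d) < a → a ≤ 1 / 2 →
      ∀ (c' : ℝ) (α γbar : ℕ → ℝ) (t₀ : ℕ), 0 < c' → MonotoneOn α (Set.Ici 1) →
      (∀ t : ℕ, 1 ≤ t → γbar t = c' * (t : ℝ) ^ ((d : ℝ) / (2 * ν + d)) * α t) →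
      ∃ (C : ℝ) (T₀ : ℕ), ∀ T : ℕ, T₀ ≤ T →
      ∀ X : Finset (EuclideanSpace ℝ (Fin d)), X.Nonempty →
        (∀ x ∈ X, ∀ i, x i ∈ Set.Icc (0 : ℝ) 1) →
        (∀ t : ℕ, t₀ ≤ t → 1 ≤ t →
          maxInfoGain (fun x y : X => maternKernel ν l (x : EuclideanSpace ℝ (Fin d)) y) σ t
            ≤ γbar t) →
        BPERegretBound.{u} (maternKernel ν l) σ a X T C (γbar T)) := by
  refine ⟨fun a ha ha1 => exists_regretBound_of_half_lt (seKernel_self l) hσ ha ha1,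
    fun ν _ a ha ha1 => exists_regretBound_of_half_lt (maternKernel_self ν l) hσ ha ha1,
    fun ν hν a ha ha1 c' α γbar t₀ hc' hα hγbar => ?_⟩
  have hden : 0 < 2 * ν + (d : ℝ) := by positivity
  have hhalf : (1 - (d : ℝ) / (2 * ν + d)) / 2 = ν / (2 * ν + d) := by
    field_simp
    ring
  exact exists_regretBound_of_growth (maternKernel_self ν l) hσ
    (lt_trans (by positivity) ha) (by linarith) (div_le_one_of_le₀ (by linarith) hden.le)
    (hhalf.trans_lt ha) hc' hα hγbar
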